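/- Let $M,N,H,H_0$ be non-negative integers with $H_0\le H$, let $\phi_U,\theta_U,\phi_V,\theta_V>0$, and let $K\subset[0,\infty)$ be compact. Let $U_0\in\mathbb R^{M\times H_0}$ and $V_0\in\mathbb R^{H_0\times N}$ have strictly positive entries, and assume that the non-negative rank of $U_0V_0$ (the least $r$ such that $U_0V_0$ is a product of an entrywise non-negative $M\times r$ matrix and an entrywise non-negative $r\times N$ matrix) equals $H_0$. Assume that the true matrix is realized in the interior of the parameter set: $U_0V_0=U_1V_1$ for some $U_1\in\mathbb R^{M\times H_0}$, $V_1\in\mathbb R^{H_0\times N}$ with all entries in the interior of $K$; and, if $H>H_0$, that $[0,\delta]\subset K$ for some $\delta>0$. For matrices $U\in K^{M\times H}$, $V\in K^{H\times N}$ let $$\varphi(U,V)=\prod_{i=1}^{M}\prod_{k=1}^{H}\frac{\theta_U^{\phi_U}}{\Gamma(\phi_U)}u_{ik}^{\phi_U-1}e^{-\theta_U u_{ik}}\;\prod_{k=1}^{H}\prod_{j=1}^{N}\frac{\theta_V^{\phi_V}}{\Gamma(\phi_V)}v_{kj}^{\phi_V-1}e^{-\theta_V v_{kj}}$$ be the product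 of gamma densities, and for $\operatorname{Re} z>0$ let $$\zeta(z)=\int_{K^{M\times H}}\int_{K^{H\times N}}\bigl(\|UV-U_0V_0\|^2\bigr)^{z}\,\varphi(U,V)\,dV\,dU ,$$ where $\|\cdot\|$ is the Euclidean (Frobenius) norm. Let $\lambda\in\mathbb R$ be the real log canonical threshold of this non-negative matrix factorization, that is, assume that $\zeta$ continues to a meromorphic function on $\mathbb C$ and that $-\lambda$ is its largest pole ($-\lambda$ is a pole, and every pole $p$ satisfies $\operatorname{Re}p\le-\lambda$). Then $$\lambda\le\frac12\Bigl[(H-H_0)\min\{M\phi_U,N\phi_V\}+H_0(M+N-1)\Bigr],$$ and equality holds if $H=H_0=1$. -/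

import Mathlib

open MeasureTheory ProbabilityTheory Set

open scoped Topology

/-- The non-negative rank of an entrywise non-negative matrix: the least inner dimension `r` of
a factorization into two entrywise non-negative matrices. -/
noncomputable def nonnegRank {M N : ℕ} (A : Matrix (Fin M) (Fin N) ℝ) : ℕ :=
  sInf {r : ℕ | ∃ (U : Matrix (Fin M) (Fin r) ℝ) (V : Matrix (Fin r) (Fin N) ℝ),
    (∀ i k, 0 ≤ U i k) ∧ (∀ k j, 0 ≤ V k j) ∧ A = U * V}

/-- The squared Euclidean (Frobenius) norm of a real matrix. -/
def frobSq {M N : ℕ} (A : Matrix (Fin M) (Fin N) ℝ) : ℝ :=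
  ∑ i, ∑ j, A i j ^ 2

/-- The density of a matrix with independent gamma distributed entries of shape `a` and
rate `r`. -/
noncomputable def matrixGammaPDF {m n : ℕ} (a r : ℝ) (A : Fin m → Fin n → ℝ) : ℝ :=
  ∏ i, ∏ j, gammaPDFReal a r (A i j)

/-- The domain of the parameter `(U, V)`: pairs of an `M × H` and an `H × N` matrix with all
entries in `K`. Matrices are written as functions so that `volume` is Lebesgue measure. -/
def nmfDomain (M N H : ℕ) (K : Set ℝ) : Set ((Fin M → Fin H → ℝ) × (Fin H → Fin N → ℝ)) :=
  {w | (∀ i k, w.1 i k ∈ K) ∧ (∀ k j, w.2 k j ∈ K)}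

/-- The zeta function `ζ(z) = ∫∫ (‖U V - A‖²)^z φ(U, V) dU dV` of non-negative matrix
factorization with true matrix `A` and independent gamma priors on the entries of `U` and `V`,
defined by the integral (which converges absolutely when `0 < re z` and `K` is bounded). -/
noncomputable def nmfZeta {M N : ℕ} (H : ℕ) (K : Set ℝ) (φU θU φV θV : ℝ)
    (A : Matrix (Fin M) (Fin N) ℝ) (z : ℂ) : ℂ :=
  ∫ w in nmfDomain M N H K,
    ((frobSq (Matrix.of w.1 * Matrix.of w.2 - A) : ℝ) : ℂ) ^ z *
      ((matrixGammaPDF φU θU w.1 * matrixGammaPDF φV θV w.2 : ℝ) : ℂ)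

/-- `p` is a pole of the function `Z`. -/
def IsPoleOf (Z : ℂ → ℂ) (p : ℂ) : Prop :=
  MeromorphicAt Z p ∧ meromorphicOrderAt Z p < 0

/-- `-l` is the largest pole of the meromorphic continuation to `ℂ` of a function `ζ` which is
given on the half plane `0 < re z`. -/
def IsLargestPoleOfContinuation (ζ : ℂ → ℂ) (l : ℝ) : Prop :=
  ∃ Z : ℂ → ℂ, MeromorphicOn Z univ ∧ (∀ z : ℂ, 0 < z.re → Z z = ζ z) ∧
    IsPoleOf Z ((-l : ℝ) : ℂ) ∧ ∀ p : ℂ, IsPoleOf Z p → p.re ≤ -l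

/-- `l` is the real log canonical threshold (RLCT) of non-negative matrix factorization with
model rank `H`, true matrix `A`, and gamma priors: `-l` is the largest pole of the zeta
function. -/
def IsNMFRLCT {M N : ℕ} (H : ℕ) (K : Set ℝ) (φU θU φV θV : ℝ)
    (A : Matrix (Fin M) (Fin N) ℝ) (l : ℝ) : Prop :=
  IsLargestPoleOfContinuation (nmfZeta H K φU θU φV θV A) l

/-! The zeta function is the complex moment generating function of the logarithm of the loss, under
the prior restricted to the parameters with positive loss. This logarithm is bounded above and the
measure is positive, so Landau's theorem applies: the defining integral converges at every real
point to the right of the largest pole of the continuation (`integrable_exp_mul_of_isPoleOf_re_le`).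
Conversely, the identity theorem excludes real poles from any half plane of convergence
(`le_of_isPoleOf_of_integrable_exp_mul`). Hence the threshold is decided by the prior mass of the
sublevel sets of the loss, with no resolution of singularities: mass of order at least `r ^ (2 * b)`
at level of order `r ^ 2` forces `l ≤ b` by Markov's inequality, and mass of order at most `r ^ n`
forces `n / 2 ≤ l` by summing over layers.

The mass is bounded below near the orbit `(U T, T⁻¹ V)`, `T` diagonal and close to the identity, of
the interior factorization. One box of side `r` around an orbit point costs `r ^ (H₀ * (M + N))`,
and the `H₀` dimensions of the orbit give back a factor `r ^ H₀`. The remaining `d = H - H₀` columns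
and rows only need products of order `r`. Shrinking the columns alone costs `r ^ (φU * d * M)`,
shrinking the rows alone costs `r ^ (φV * d * N)`, whence the minimum. This is
`exists_le_nmfMeasure_sublevel`.

For `H = H₀ = 1`, every parameter of small loss lies near the one-dimensional rescaling orbit, which
gives a mass bound of the matching order `r ^ (M + N - 1)` from above
(`exists_nmfMeasure_sublevel_le`). In both directions the union of boxes along the orbit is measured
by Fubini on pairs (scaling, parameter). -/

/-! ### Landau's theorem and poles of continued moment generating functions -/

section Continuation

variable {Ω : Type*} [MeasurableSpace Ω] {μ : Measure Ω} {X : Ω → ℝ}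

lemma integrable_exp_mul_of_nonneg_of_ae_le [IsFiniteMeasure μ] (hX : Measurable X) {C : ℝ}
    (hXC : ∀ᵐ ω ∂μ, X ω ≤ C) {t : ℝ} (ht : 0 ≤ t) : Integrable (fun ω ↦ Real.exp (t * X ω)) μ := by
  refine Integrable.of_bound (by fun_prop) (Real.exp (t * C)) ?_
  filter_upwards [hXC] with ω hω
  rw [Real.norm_eq_abs, abs_of_pos (Real.exp_pos _)]
  gcongr

lemma mem_interior_integrableExpSet_of_ae_le [IsFiniteMeasure μ] (hX : Measurable X) {C : ℝ}
    (hXC : ∀ᵐ ω ∂μ, X ω ≤ C) {t : ℝ} (ht : 0 < t) : t ∈ interior (integrableExpSet X μ) := by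
  have : Ici (0 : ℝ) ⊆ integrableExpSet X μ := fun s hs ↦
    integrable_exp_mul_of_nonneg_of_ae_le hX hXC hs
  exact interior_mono this (by rw [interior_Ici]; exact ht)

/-- **Landau's theorem** for moment generating functions of a nonpositive random variable: if the
complex moment generating function extends holomorphically to a ball around `1`, then it converges
on the whole real diameter of this ball. -/
lemma integrable_exp_mul_of_differentiableOn_ball [IsFiniteMeasure μ] (hX : Measurable X)
    (hX0 : ∀ᵐ ω ∂μ, X ω ≤ 0) {f : ℂ → ℂ} {R : ℝ} (hf : DifferentiableOn ℂ f (Metric.ball 1 R))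
    (hfX : f =ᶠ[𝓝 1] complexMGF X μ) {x : ℝ} (hx : x < 1) (hxR : 1 - R < x) :
    Integrable (fun ω ↦ Real.exp (x * X ω)) μ := by
  have hint : (1 : ℂ).re ∈ interior (integrableExpSet X μ) :=
    mem_interior_integrableExpSet_of_ae_le hX hX0 (by simp)
  have hball : (x : ℂ) ∈ Metric.ball (1 : ℂ) R := by
    rw [mem_ball_iff_norm, show (x : ℂ) - 1 = ((x - 1 : ℝ) : ℂ) by push_cast; ring,
      Complex.norm_real, Real.norm_eq_abs, abs_of_neg (by linarith)]
    linarith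
  have hsum := (Complex.hasSum_taylorSeries_on_ball hf hball).summable.norm
  -- Expand `exp (x X) = exp X * exp ((x - 1) X)`. Since `x < 1` and `X ≤ 0`, all terms are
  -- nonnegative, and their integrals are the Taylor terms of `f` at `1`, evaluated at `x`. Tonelli
  -- then turns convergence of the Taylor series into integrability.
  set T : ℕ → Ω → ℝ := fun n ω ↦
    ((n.factorial : ℝ)⁻¹ * ((x - 1) * X ω) ^ n) * Real.exp (X ω) with hT
  have hTnn : ∀ᵐ ω ∂μ, ∀ n, 0 ≤ T n ω := by
    filter_upwards [hX0] with ω hω n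
    have : 0 ≤ (x - 1) * X ω := mul_nonneg_of_nonpos_of_nonpos (by linarith) hω
    positivity
  have hTint (n : ℕ) : Integrable (T n) μ := by
    have := (integrable_pow_mul_exp_of_mem_interior_integrableExpSet (X := X) (μ := μ)
      (by simpa using hint) n).const_mul ((n.factorial : ℝ)⁻¹ * (x - 1) ^ n)
    refine this.congr (Filter.Eventually.of_forall fun ω ↦ ?_)
    simp only [hT, mul_pow, one_mul]
    ring
  have hterm (n : ℕ) : ‖((n.factorial : ℂ)⁻¹ • ((x : ℂ) - 1) ^ n • iteratedDeriv n f 1)‖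
      = ∫ ω, T n ω ∂μ := by
    have h1 : iteratedDeriv n f 1 = ((∫ ω, X ω ^ n * Real.exp (X ω) ∂μ : ℝ) : ℂ) := by
      rw [hfX.iteratedDeriv_eq, iteratedDeriv_complexMGF hint, ← integral_complex_ofReal]
      congr 1 with ω
      push_cast
      simp
    have h2 : (n.factorial : ℂ)⁻¹ • ((x : ℂ) - 1) ^ n • iteratedDeriv n f 1
        = ((∫ ω, T n ω ∂μ : ℝ) : ℂ) := by
      rw [h1, smul_eq_mul, smul_eq_mul, ← mul_assoc]
      have : ∫ ω, T n ω ∂μ = ((n.factorial : ℝ)⁻¹ * (x - 1) ^ n) *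
          ∫ ω, X ω ^ n * Real.exp (X ω) ∂μ := by
        rw [← integral_const_mul]
        congr 1 with ω
        simp only [hT, mul_pow]
        ring
      rw [this]
      push_cast
      ring
    rw [h2, Complex.norm_real, Real.norm_eq_abs, abs_of_nonneg]
    exact integral_nonneg_of_ae (hTnn.mono fun ω h ↦ h n)
  simp_rw [hterm] at hsum
  have hexp : ∀ ω, HasSum (fun n ↦ T n ω) (Real.exp (x * X ω)) := by
    intro ω
    have h := (NormedSpace.expSeries_div_hasSum_exp ((x - 1) * X ω)).mul_right (Real.exp (X ω))
    rw [← Real.exp_eq_exp_ℝ, ← Real.exp_add] at h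
    rw [show (x - 1) * X ω + X ω = x * X ω by ring] at h
    have e : (fun n ↦ T n ω) = fun n ↦ ((x - 1) * X ω) ^ n / n.factorial * Real.exp (X ω) := by
      funext n
      simp only [hT]
      ring
    rw [e]
    exact h
  refine ⟨by fun_prop, ?_⟩
  rw [hasFiniteIntegral_iff_ofReal (Filter.Eventually.of_forall fun ω ↦ (Real.exp_pos _).le)]
  have hlin : ∫⁻ ω, ENNReal.ofReal (Real.exp (x * X ω)) ∂μ
      = ∑' n, ENNReal.ofReal (∫ ω, T n ω ∂μ) := by
    calc _ = ∫⁻ ω, ∑' n, ENNReal.ofReal (T n ω) ∂μ := by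
          refine lintegral_congr_ae ?_
          filter_upwards [hTnn] with ω hω
          rw [← ENNReal.ofReal_tsum_of_nonneg hω (hexp ω).summable, (hexp ω).tsum_eq]
      _ = ∑' n, ∫⁻ ω, ENNReal.ofReal (T n ω) ∂μ :=
          lintegral_tsum fun n ↦ (hTint n).aemeasurable.ennreal_ofReal
      _ = _ := by
          congr 1 with n
          rw [ofReal_integral_eq_lintegral_ofReal (hTint n) (hTnn.mono fun ω h ↦ h n)]
  rw [hlin, ← ENNReal.ofReal_tsum_of_nonneg
    (fun n ↦ integral_nonneg_of_ae (hTnn.mono fun ω h ↦ h n)) hsum]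
  exact ENNReal.ofReal_lt_top

lemma complexMGF_sub_const (C : ℝ) (z : ℂ) :
    complexMGF (fun ω ↦ X ω - C) μ z = Complex.exp (-(C * z)) * complexMGF X μ z := by
  simp only [complexMGF, ← integral_const_mul, ← Complex.exp_add]
  congr 1 with ω
  push_cast
  ring_nf

/-- Landau's theorem for moment generating functions of a random variable which is bounded above:
the integral converges up to the real part of the rightmost pole of the continuation. -/
theorem integrable_exp_mul_of_isPoleOf_re_le [IsFiniteMeasure μ] (hX : Measurable X) {C : ℝ}
    (hXC : ∀ᵐ ω ∂μ, X ω ≤ C) {Z : ℂ → ℂ} (hZ : MeromorphicOn Z univ)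
    (hZX : ∀ z : ℂ, 0 < z.re → Z z = complexMGF X μ z) {l : ℝ}
    (hl : ∀ p : ℂ, IsPoleOf Z p → p.re ≤ -l) {x : ℝ} (hx : -l < x) :
    Integrable (fun ω ↦ Real.exp (x * X ω)) μ := by
  rcases le_or_gt 0 x with hx0 | hx0
  · exact integrable_exp_mul_of_nonneg_of_ae_le hX hXC hx0
  set W := toMeromorphicNFOn Z univ
  have hWan (z : ℂ) (hz : -l < z.re) : AnalyticAt ℂ W z := by
    have hNF : MeromorphicNFAt W z := meromorphicNFOn_toMeromorphicNFOn Z univ (mem_univ z)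
    rw [← hNF.meromorphicOrderAt_nonneg_iff_analyticAt,
      meromorphicOrderAt_toMeromorphicNFOn hZ (mem_univ z)]
    by_contra! h
    linarith [hl z ⟨hZ z (mem_univ z), h⟩]
  have hre : ∀ᶠ z : ℂ in 𝓝 1, 0 < z.re :=
    (isOpen_lt continuous_const Complex.continuous_re).mem_nhds (by simp)
  have hWX : W =ᶠ[𝓝 1] complexMGF X μ := by
    have h1 : W =ᶠ[𝓝[≠] 1] complexMGF X μ := by
      filter_upwards [hZ.toMeromorphicNFOn_eq_self_on_nhdsNE (mem_univ 1),
        hre.filter_mono nhdsWithin_le_nhds] with z hz hz'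
      exact hz.trans (hZX z hz')
    refine (AnalyticAt.frequently_eq_iff_eventually_eq (hWan 1 (by simp; linarith)) ?_).1
      h1.frequently
    exact analyticAt_complexMGF (mem_interior_integrableExpSet_of_ae_le hX hXC (by simp))
  -- Subtracting `C` makes the variable nonpositive and multiplies the transform by an entire
  -- factor. The ball of radius `1 + l` around `1` lies in the pole-free half plane.
  have key : Integrable (fun ω ↦ Real.exp (x * (X ω - C))) μ := by
    refine integrable_exp_mul_of_differentiableOn_ball (X := fun ω ↦ X ω - C) (by fun_prop)
      (hXC.mono fun ω h ↦ by linarith) (f := fun z ↦ Complex.exp (-(C * z)) * W z) (R := 1 + l)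
      ?_ ?_ (by linarith) (by linarith)
    · intro z hz
      have hz' : -l < z.re := by
        have h1 := Complex.abs_re_le_norm (z - 1)
        rw [mem_ball_iff_norm] at hz
        have h2 := neg_abs_le (z - 1).re
        simp only [Complex.sub_re, Complex.one_re] at h1 h2
        linarith
      exact (DifferentiableAt.mul (by fun_prop) (hWan z hz').differentiableAt).differentiableWithinAt
    · filter_upwards [hWX] with z hz
      rw [complexMGF_sub_const, hz]
  refine (key.const_mul (Real.exp (x * C))).congr (Filter.Eventually.of_forall fun ω ↦ ?_)
  simp only [← Real.exp_add]
  ring_nf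

/-- The continuation of a moment generating function has no poles inside the strip of
convergence. -/
theorem le_of_isPoleOf_of_integrable_exp_mul {Z : ℂ → ℂ} (hZ : MeromorphicOn Z univ)
    (hZX : ∀ z : ℂ, 0 < z.re → Z z = complexMGF X μ z) {s : ℝ} (hs : 0 < s)
    (hint : ∀ x : ℝ, -s < x → Integrable (fun ω ↦ Real.exp (x * X ω)) μ) {p : ℝ}
    (hp : IsPoleOf Z p) : p ≤ -s := by
  by_contra! hlt
  have hsub : Ioi (-s) ⊆ interior (integrableExpSet X μ) :=
    isOpen_Ioi.subset_interior_iff.2 fun x hx ↦ hint x hx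
  set U : Set ℂ := {z | -s < z.re}
  have han (z : ℂ) (hz : z ∈ U) : AnalyticAt ℂ (complexMGF X μ) z := analyticAt_complexMGF (hsub hz)
  have hmer : MeromorphicOn (fun z ↦ Z z - complexMGF X μ z) U := fun z hz ↦
    (hZ z (mem_univ z)).fun_sub (han z hz).meromorphicAt
  have hconn : IsPreconnected U := (convex_halfSpace_re_gt (-s)).isPreconnected
  have hp' : (p : ℂ) ∈ U := by simpa [U] using hlt
  have h1 : (1 : ℂ) ∈ U := by simp [U]; linarith
  -- Identity theorem: the difference vanishes near `1`, and infinite order propagates through the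
  -- connected half plane.
  have htop : meromorphicOrderAt (fun z ↦ Z z - complexMGF X μ z) (p : ℂ) = ⊤ := by
    by_contra hne
    refine hmer.meromorphicOrderAt_ne_top_of_isPreconnected hconn hp' h1 hne ?_
    rw [meromorphicOrderAt_eq_top_iff]
    have hre : ∀ᶠ z : ℂ in 𝓝 1, 0 < z.re :=
      (isOpen_lt continuous_const Complex.continuous_re).mem_nhds (by simp)
    filter_upwards [hre.filter_mono nhdsWithin_le_nhds] with z hz
    rw [hZX z hz, sub_self]
  rw [meromorphicOrderAt_eq_top_iff] at htop
  have hcongr : Z =ᶠ[𝓝[≠] (p : ℂ)] complexMGF X μ := by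
    filter_upwards [htop] with z hz using sub_eq_zero.1 hz
  have := hp.2
  rw [meromorphicOrderAt_congr hcongr] at this
  exact absurd (han _ hp').meromorphicOrderAt_nonneg (not_le.2 this)

end Continuation

/-! ### Products of densities and the prior as a product measure -/

section PiWithDensity

variable {E : Type*} [MeasurableSpace E]

lemma lintegral_pi_prod_eq_prod_lintegral {n : ℕ} {μ : Measure E} [SigmaFinite μ]
    {f : Fin n → E → ENNReal} (hf : ∀ i, Measurable (f i)) :
    ∫⁻ x, ∏ i, f i (x i) ∂(Measure.pi fun _ : Fin n ↦ μ) = ∏ i, ∫⁻ x, f i x ∂μ := by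
  induction n with
  | zero => simp
  | succ n ih =>
    calc
      _ = ∫⁻ x : E × (Fin n → E), f 0 x.1 * ∏ i : Fin n, f (Fin.succ i) (x.2 i)
            ∂(μ.prod (Measure.pi fun _ ↦ μ)) := by
          rw [← ((measurePreserving_piFinSuccAbove (fun _ : Fin (n + 1) ↦ μ)
            0).symm).lintegral_comp_emb (MeasurableEquiv.measurableEmbedding _)]
          simp_rw [MeasurableEquiv.piFinSuccAbove_symm_apply, Fin.insertNthEquiv,
            Fin.prod_univ_succ, Fin.insertNth_zero, Equiv.coe_fn_mk, Fin.cons_succ,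
            Fin.cons_zero]
          rfl
      _ = (∫⁻ x, f 0 x ∂μ) * ∏ i : Fin n, ∫⁻ x, f (Fin.succ i) x ∂μ := by
          rw [← ih fun i ↦ hf _, ← lintegral_prod_mul (hf 0).aemeasurable]
          exact (Finset.measurable_prod _ fun i _ ↦
            (hf i.succ).comp (measurable_pi_apply i)).aemeasurable
      _ = _ := by rw [Fin.prod_univ_succ]

lemma pi_withDensity_eq_withDensity_prod {n : ℕ} {μ : Measure E} [SigmaFinite μ] {f : E → ENNReal}
    (hf : Measurable f) [SigmaFinite (μ.withDensity f)] :
    Measure.pi (fun _ : Fin n ↦ μ.withDensity f)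
      = (Measure.pi fun _ : Fin n ↦ μ).withDensity fun x ↦ ∏ i, f (x i) := by
  refine Measure.pi_eq fun s hs ↦ ?_
  rw [withDensity_apply _ (MeasurableSet.univ_pi hs), ← lintegral_indicator (MeasurableSet.univ_pi hs)]
  have h : ∀ x : Fin n → E, (univ.pi s).indicator (fun x ↦ ∏ i, f (x i)) x
      = ∏ i, (s i).indicator f (x i) := by
    intro x
    by_cases hx : x ∈ univ.pi s
    · rw [indicator_of_mem hx]
      exact Finset.prod_congr rfl fun i _ ↦ (indicator_of_mem (hx i (mem_univ i)) f).symm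
    · rw [indicator_of_notMem hx]
      simp only [mem_univ_pi, not_forall] at hx
      obtain ⟨i, hi⟩ := hx
      exact (Finset.prod_eq_zero (Finset.mem_univ i) (indicator_of_notMem hi f)).symm
  simp_rw [h]
  rw [lintegral_pi_prod_eq_prod_lintegral fun i ↦ hf.indicator (hs i)]
  exact Finset.prod_congr rfl fun i _ ↦ by
    rw [lintegral_indicator (hs i), withDensity_apply _ (hs i)]

end PiWithDensity

/-- The law of an `m × n` matrix with independent gamma distributed entries of shape `a` and
rate `r`. -/
noncomputable def matrixGammaMeasure (m n : ℕ) (a r : ℝ) : Measure (Fin m → Fin n → ℝ) :=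
  Measure.pi fun _ ↦ Measure.pi fun _ ↦ gammaMeasure a r

section MatrixGamma

variable {m n : ℕ} {a r : ℝ}

lemma isProbabilityMeasure_matrixGammaMeasure (ha : 0 < a) (hr : 0 < r) :
    IsProbabilityMeasure (matrixGammaMeasure m n a r) := by
  have := isProbabilityMeasure_gammaMeasure ha hr
  unfold matrixGammaMeasure
  infer_instance

lemma measurable_matrixGammaPDF : Measurable (matrixGammaPDF (m := m) (n := n) a r) := by
  unfold matrixGammaPDF
  refine Finset.measurable_fun_prod _ fun i _ ↦ Finset.measurable_fun_prod _ fun j _ ↦ ?_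
  exact (measurable_gammaPDFReal a r).comp (by fun_prop)

lemma matrixGammaPDF_nonneg (ha : 0 < a) (hr : 0 < r) (A : Fin m → Fin n → ℝ) :
    0 ≤ matrixGammaPDF a r A :=
  Finset.prod_nonneg fun _ _ ↦ Finset.prod_nonneg fun _ _ ↦ gammaPDFReal_nonneg ha hr _

lemma matrixGammaMeasure_eq_withDensity (ha : 0 < a) (hr : 0 < r) :
    matrixGammaMeasure m n a r
      = volume.withDensity fun A ↦ ENNReal.ofReal (matrixGammaPDF a r A) := by
  have := isProbabilityMeasure_gammaMeasure ha hr
  have hm : Measurable (gammaPDF a r) := (measurable_gammaPDFReal a r).ennreal_ofReal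
  have h1 : (Measure.pi fun _ : Fin n ↦ gammaMeasure a r)
      = (volume : Measure (Fin n → ℝ)).withDensity fun x ↦ ∏ i, gammaPDF a r (x i) := by
    have : IsProbabilityMeasure ((volume : Measure ℝ).withDensity (gammaPDF a r)) := this
    exact pi_withDensity_eq_withDensity_prod hm
  have h2 : IsProbabilityMeasure
      ((volume : Measure (Fin n → ℝ)).withDensity fun x ↦ ∏ i, gammaPDF a r (x i)) := by
    rw [← h1]; infer_instance
  unfold matrixGammaMeasure
  have hp : Measurable fun x : Fin n → ℝ ↦ ∏ i, gammaPDF a r (x i) :=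
    Finset.measurable_fun_prod _ fun i _ ↦ hm.comp (measurable_pi_apply i)
  rw [h1, pi_withDensity_eq_withDensity_prod hp]
  have hd : (fun A : Fin m → Fin n → ℝ ↦ ∏ i, ∏ j, gammaPDF a r (A i j))
      = fun A ↦ ENNReal.ofReal (matrixGammaPDF a r A) := by
    funext A
    simp only [matrixGammaPDF, gammaPDF]
    rw [ENNReal.ofReal_prod_of_nonneg fun _ _ ↦
      Finset.prod_nonneg fun _ _ ↦ gammaPDFReal_nonneg ha hr _]
    refine Finset.prod_congr rfl fun i _ ↦ ?_
    rw [ENNReal.ofReal_prod_of_nonneg fun _ _ ↦ gammaPDFReal_nonneg ha hr _]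
  rw [hd]
  rfl

end MatrixGamma

/-! ### The loss and the zeta function as a moment generating function -/

/-- The squared error `‖U V - A‖²` of the factorization `(U, V)` of `A`. -/
def nmfLoss {M N : ℕ} (H : ℕ) (A : Matrix (Fin M) (Fin N) ℝ)
    (w : (Fin M → Fin H → ℝ) × (Fin H → Fin N → ℝ)) : ℝ :=
  frobSq (Matrix.of w.1 * Matrix.of w.2 - A)

/-- The prior law of `(U, V)`, restricted to the parameters in the domain with positive loss. -/
noncomputable def nmfMeasure {M N : ℕ} (H : ℕ) (K : Set ℝ) (φU θU φV θV : ℝ)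
    (A : Matrix (Fin M) (Fin N) ℝ) : Measure ((Fin M → Fin H → ℝ) × (Fin H → Fin N → ℝ)) :=
  ((matrixGammaMeasure M H φU θU).prod (matrixGammaMeasure H N φV θV)).restrict
    (nmfDomain M N H K ∩ {w | 0 < nmfLoss H A w})

section Loss

variable {M N H : ℕ} {A : Matrix (Fin M) (Fin N) ℝ}

lemma nmfLoss_eq (w : (Fin M → Fin H → ℝ) × (Fin H → Fin N → ℝ)) :
    nmfLoss H A w = ∑ i, ∑ j, (∑ k, w.1 i k * w.2 k j - A i j) ^ 2 := by
  simp [nmfLoss, frobSq, Matrix.mul_apply]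

lemma nmfLoss_nonneg (w : (Fin M → Fin H → ℝ) × (Fin H → Fin N → ℝ)) : 0 ≤ nmfLoss H A w := by
  rw [nmfLoss_eq]
  positivity

lemma sq_sub_le_nmfLoss (w : (Fin M → Fin H → ℝ) × (Fin H → Fin N → ℝ)) (i : Fin M) (j : Fin N) :
    (∑ k, w.1 i k * w.2 k j - A i j) ^ 2 ≤ nmfLoss H A w := by
  rw [nmfLoss_eq]
  refine le_trans ?_ (Finset.single_le_sum
    (f := fun i ↦ ∑ j, (∑ k, w.1 i k * w.2 k j - A i j) ^ 2) (fun _ _ ↦ by positivity)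
    (Finset.mem_univ i))
  exact Finset.single_le_sum (f := fun j ↦ (∑ k, w.1 i k * w.2 k j - A i j) ^ 2)
    (fun _ _ ↦ by positivity) (Finset.mem_univ j)

lemma continuous_nmfLoss : Continuous (nmfLoss H A) := by
  simp_rw [funext nmfLoss_eq]
  fun_prop

lemma measurableSet_nmfDomain {K : Set ℝ} (hK : MeasurableSet K) :
    MeasurableSet (nmfDomain M N H K) := by
  have : nmfDomain M N H K = (⋂ i, ⋂ k, (fun w ↦ w.1 i k) ⁻¹' K) ∩
      ⋂ k, ⋂ j, (fun w ↦ w.2 k j) ⁻¹' K := by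
    ext w
    simp [nmfDomain]
  rw [this]
  refine (MeasurableSet.iInter fun i ↦ MeasurableSet.iInter fun k ↦ ?_).inter
    (MeasurableSet.iInter fun i ↦ MeasurableSet.iInter fun k ↦ ?_)
  · exact (by fun_prop : Measurable fun w : (Fin M → Fin H → ℝ) × (Fin H → Fin N → ℝ) ↦ w.1 i k) hK
  · exact (by fun_prop : Measurable fun w : (Fin M → Fin H → ℝ) × (Fin H → Fin N → ℝ) ↦ w.2 i k) hK

lemma isCompact_nmfDomain {K : Set ℝ} (hK : IsCompact K) : IsCompact (nmfDomain M N H K) := by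
  have : nmfDomain M N H K = (univ.pi fun _ ↦ univ.pi fun _ ↦ K) ×ˢ
      (univ.pi fun _ ↦ univ.pi fun _ ↦ K) := by
    ext w
    simp [nmfDomain]
  rw [this]
  exact (isCompact_univ_pi fun _ ↦ isCompact_univ_pi fun _ ↦ hK).prod
    (isCompact_univ_pi fun _ ↦ isCompact_univ_pi fun _ ↦ hK)

lemma exists_nmfLoss_le {K : Set ℝ} (hK : IsCompact K) :
    ∃ B : ℝ, 0 < B ∧ ∀ w ∈ nmfDomain M N H K, nmfLoss H A w ≤ B := by
  obtain ⟨B, hB⟩ := (isCompact_nmfDomain (M := M) (N := N) (H := H) hK).bddAbove_image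
    (continuous_nmfLoss (A := A)).continuousOn
  exact ⟨max B 1, by positivity, fun w hw ↦ le_max_of_le_left (hB (mem_image_of_mem _ hw))⟩

variable {K : Set ℝ} {φU θU φV θV : ℝ}

lemma isFiniteMeasure_nmfMeasure (hφU : 0 < φU) (hθU : 0 < θU) (hφV : 0 < φV) (hθV : 0 < θV) :
    IsFiniteMeasure (nmfMeasure H K φU θU φV θV A) := by
  have := isProbabilityMeasure_matrixGammaMeasure (m := M) (n := H) hφU hθU
  have := isProbabilityMeasure_matrixGammaMeasure (m := H) (n := N) hφV hθV
  unfold nmfMeasure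
  infer_instance

lemma measurableSet_nmfDomain_inter_pos (hK : MeasurableSet K) :
    MeasurableSet (nmfDomain M N H K ∩ {w | 0 < nmfLoss H A w}) :=
  (measurableSet_nmfDomain hK).inter
    (measurableSet_lt measurable_const continuous_nmfLoss.measurable)

/-- The zeta function is the complex moment generating function of the logarithm of the loss. -/
lemma nmfZeta_eq_complexMGF (hK : MeasurableSet K) (hφU : 0 < φU) (hθU : 0 < θU) (hφV : 0 < φV)
    (hθV : 0 < θV) {z : ℂ} (hz : z ≠ 0) :
    nmfZeta H K φU θU φV θV A z
      = complexMGF (fun w ↦ Real.log (nmfLoss H A w)) (nmfMeasure H K φU θU φV θV A) z := by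
  have h1 := isProbabilityMeasure_matrixGammaMeasure (m := M) (n := H) hφU hθU
  have h2 := isProbabilityMeasure_matrixGammaMeasure (m := H) (n := N) hφV hθV
  have hmU : Measurable fun B : Fin M → Fin H → ℝ ↦ ENNReal.ofReal (matrixGammaPDF φU θU B) :=
    measurable_matrixGammaPDF.ennreal_ofReal
  have hmV : Measurable fun B : Fin H → Fin N → ℝ ↦ ENNReal.ofReal (matrixGammaPDF φV θV B) :=
    measurable_matrixGammaPDF.ennreal_ofReal
  have hS := measurableSet_nmfDomain_inter_pos (M := M) (N := N) (H := H) (A := A) hK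
  have hP : (matrixGammaMeasure M H φU θU).prod (matrixGammaMeasure H N φV θV)
      = volume.withDensity fun w ↦
        ENNReal.ofReal (matrixGammaPDF φU θU w.1 * matrixGammaPDF φV θV w.2) := by
    rw [matrixGammaMeasure_eq_withDensity hφU hθU] at h1 ⊢
    rw [matrixGammaMeasure_eq_withDensity hφV hθV] at h2 ⊢
    rw [prod_withDensity hmU hmV]
    congr 1
    funext w
    rw [ENNReal.ofReal_mul (matrixGammaPDF_nonneg hφU hθU _)]
  have hmUV : Measurable fun w : (Fin M → Fin H → ℝ) × (Fin H → Fin N → ℝ) ↦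
      ENNReal.ofReal (matrixGammaPDF φU θU w.1 * matrixGammaPDF φV θV w.2) :=
    ((measurable_matrixGammaPDF.comp measurable_fst).mul
      (measurable_matrixGammaPDF.comp measurable_snd)).ennreal_ofReal
  rw [complexMGF, nmfMeasure, hP, restrict_withDensity hS,
    integral_withDensity_eq_integral_toReal_smul hmUV
      (Filter.Eventually.of_forall fun _ ↦ ENNReal.ofReal_lt_top), nmfZeta,
    ← integral_indicator hS, ← integral_indicator (measurableSet_nmfDomain hK)]
  congr 1
  funext w
  by_cases hw : w ∈ nmfDomain M N H K
  · rw [indicator_of_mem hw]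
    change ((nmfLoss H A w : ℝ) : ℂ) ^ z * _ = _
    -- At zero loss the integrand is `0 ^ z = 0`, whereas `Real.log 0 = 0` would contribute `exp 0 =
    -- 1`. This is why `nmfMeasure` discards the zero set.
    rcases (nmfLoss_nonneg (A := A) w).eq_or_lt with h0 | h0
    · rw [indicator_of_notMem fun h ↦ h.2.ne h0, ← h0]
      simp [hz]
    · have hw' : w ∈ nmfDomain M N H K ∩ {w | 0 < nmfLoss H A w} := ⟨hw, h0⟩
      rw [indicator_of_mem hw', ENNReal.toReal_ofReal
        (mul_nonneg (matrixGammaPDF_nonneg hφU hθU _) (matrixGammaPDF_nonneg hφV hθV _)),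
        Complex.cpow_def_of_ne_zero (by exact_mod_cast h0.ne'), ← Complex.ofReal_log h0.le,
        Complex.real_smul, mul_comm, mul_comm z]
  · rw [indicator_of_notMem hw, indicator_of_notMem fun h ↦ hw h.1]

end Loss

/-! ### Gamma measure of small intervals -/

section GammaInterval

variable {a r : ℝ}

lemma continuousOn_gammaPDFReal : ContinuousOn (gammaPDFReal a r) (Ioi 0) := by
  have : ContinuousOn (fun x : ℝ ↦ r ^ a / Real.Gamma a * x ^ (a - 1) * Real.exp (-(r * x)))
      (Ioi 0) := by
    refine (continuousOn_const.mul ?_).mul (by fun_prop)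
    exact continuousOn_id.rpow_const fun x hx ↦ Or.inl (ne_of_gt hx)
  refine this.congr fun x hx ↦ ?_
  rw [gammaPDFReal, if_pos (le_of_lt hx)]

lemma ofReal_mul_volume_le_gammaMeasure {c : ℝ} {s : Set ℝ} (hs : MeasurableSet s)
    (h : ∀ x ∈ s, c ≤ gammaPDFReal a r x) : ENNReal.ofReal c * volume s ≤ gammaMeasure a r s := by
  rw [gammaMeasure, withDensity_apply _ hs, ← setLIntegral_const]
  exact setLIntegral_mono' hs fun x hx ↦ ENNReal.ofReal_le_ofReal (h x hx)

lemma exists_mul_le_gammaMeasure_Ioo (ha : 0 < a) (hr : 0 < r) {x₀ x₁ : ℝ} (hx₀ : 0 < x₀) :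
    ∃ c : ℝ, 0 < c ∧ ∀ x h : ℝ, x₀ ≤ x → 0 ≤ h → x + h ≤ x₁ →
      ENNReal.ofReal (c * h) ≤ gammaMeasure a r (Ioo x (x + h)) := by
  obtain ⟨c, hc, hmin⟩ := (isCompact_Icc (a := x₀) (b := x₁)).exists_forall_le'
    (continuousOn_gammaPDFReal.mono fun x hx ↦ hx₀.trans_le hx.1) (a := 0)
    fun x hx ↦ gammaPDFReal_pos ha hr (hx₀.trans_le hx.1)
  refine ⟨c, hc, fun x h hx hh hxh ↦ ?_⟩
  refine le_trans (le_of_eq ?_) (ofReal_mul_volume_le_gammaMeasure measurableSet_Ioo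
    fun y hy ↦ hmin y ⟨hx.trans hy.1.le, hy.2.le.trans hxh⟩)
  rw [Real.volume_Ioo, ENNReal.ofReal_mul hc.le]
  ring_nf

/-- The density behaves like `x ^ (a - 1)` at `0`. On the upper half `(p / 2, p)` one has `x ^ a / x
≥ (p / 2) ^ a / p`, whatever the sign of `a - 1`. -/
lemma exists_rpow_le_gammaMeasure_Ioo_zero (ha : 0 < a) (hr : 0 < r) :
    ∃ c : ℝ, 0 < c ∧ ∀ p : ℝ, 0 < p → p ≤ 1 →
      ENNReal.ofReal (c * p ^ a) ≤ gammaMeasure a r (Ioo 0 p) := by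
  have hΓ := Real.Gamma_pos_of_pos ha
  set c₀ : ℝ := r ^ a / Real.Gamma a * (2 : ℝ)⁻¹ ^ a * Real.exp (-r)
  have hc₀ : 0 < c₀ := by positivity
  refine ⟨c₀ / 2, by positivity, fun p hp hp1 ↦ ?_⟩
  refine le_trans ?_ (measure_mono (Ioo_subset_Ioo_left (by positivity : (0 : ℝ) ≤ p / 2)))
  refine le_trans (le_of_eq ?_) (ofReal_mul_volume_le_gammaMeasure (c := c₀ * (p ^ a / p))
    measurableSet_Ioo fun x hx ↦ ?_)
  · rw [Real.volume_Ioo, ← ENNReal.ofReal_mul (by positivity)]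
    congr 1
    field_simp
    ring
  · have hx0 : 0 < x := (half_pos hp).trans hx.1
    rw [gammaPDFReal, if_pos hx0.le]
    have h1 : (2 : ℝ)⁻¹ ^ a * (p ^ a / p) ≤ x ^ (a - 1) := by
      rw [Real.rpow_sub_one hx0.ne', ← mul_div_assoc, ← Real.mul_rpow (by norm_num) hp.le]
      have h2 : 2⁻¹ * p ≤ x := by linarith [hx.1]
      have h3 : x ≤ p := hx.2.le
      gcongr
    have h4 : Real.exp (-r) ≤ Real.exp (-(r * x)) := by
      gcongr
      nlinarith [hx.2]
    calc c₀ * (p ^ a / p)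
        = r ^ a / Real.Gamma a * ((2 : ℝ)⁻¹ ^ a * (p ^ a / p)) * Real.exp (-r) := by ring
      _ ≤ _ := by gcongr

/-- The intersection with `Icc x₀ x₁` keeps away from `0`, where the density is unbounded for small
shape. -/
lemma exists_gammaMeasure_Icc_inter_le {x₀ x₁ : ℝ} (hx₀ : 0 < x₀) :
    ∃ C : ℝ, 0 < C ∧ ∀ x h : ℝ,
      gammaMeasure a r (Icc (x - h) (x + h) ∩ Icc x₀ x₁) ≤ ENNReal.ofReal (C * h) := by
  obtain ⟨C, hC⟩ := (isCompact_Icc (a := x₀) (b := x₁)).bddAbove_image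
    (continuousOn_gammaPDFReal (a := a) (r := r) |>.mono fun x hx ↦ hx₀.trans_le hx.1)
  refine ⟨2 * max C 1, by positivity, fun x h ↦ ?_⟩
  have hs : MeasurableSet (Icc (x - h) (x + h) ∩ Icc x₀ x₁) := measurableSet_Icc.inter measurableSet_Icc
  rw [gammaMeasure, withDensity_apply _ hs]
  calc _ ≤ ∫⁻ _ in Icc (x - h) (x + h) ∩ Icc x₀ x₁, ENNReal.ofReal (max C 1) :=
        setLIntegral_mono' hs fun y hy ↦
          ENNReal.ofReal_le_ofReal (le_max_of_le_left (hC (mem_image_of_mem _ hy.2)))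
    _ ≤ ENNReal.ofReal (max C 1) * volume (Icc (x - h) (x + h)) := by
        rw [setLIntegral_const]
        gcongr
        exact inter_subset_left
    _ = _ := by
        rw [Real.volume_Icc, ← ENNReal.ofReal_mul (by positivity)]
        ring_nf

end GammaInterval

/-! ### Double counting by Fubini -/

section Averaging

variable {T W : Type*} [MeasurableSpace T] [MeasurableSpace W] {ν : Measure T} {P : Measure W}
  [SFinite ν] [SFinite P] {S : Set (T × W)} {T₀ : Set T} {G : Set W} {a b : ENNReal}

/-- Both sides bound the product measure of `S`, sliced in the two directions. With `t` a scaling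
and `w` a parameter, this measures a union of boxes along an orbit without a change of variables. -/
lemma mul_measure_le_of_le_section (hS : MeasurableSet S) (hT₀ : MeasurableSet T₀)
    (hG : MeasurableSet G) (ha : ∀ t ∈ T₀, a ≤ P {w | (t, w) ∈ S})
    (hb : ∀ w, ν {t | (t, w) ∈ S} ≤ b) (hSG : ∀ t w, (t, w) ∈ S → w ∈ G) :
    a * ν T₀ ≤ b * P G := by
  calc a * ν T₀ = ∫⁻ _ in T₀, a ∂ν := (setLIntegral_const _ _).symm
    _ ≤ ∫⁻ t in T₀, P {w | (t, w) ∈ S} ∂ν := setLIntegral_mono' hT₀ ha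
    _ ≤ ∫⁻ t, P {w | (t, w) ∈ S} ∂ν := setLIntegral_le_lintegral _ _
    _ = ν.prod P S := (Measure.prod_apply hS).symm
    _ = ∫⁻ w, ν {t | (t, w) ∈ S} ∂P := Measure.prod_apply_symm hS
    _ ≤ ∫⁻ w, G.indicator (fun _ ↦ b) w ∂P := by
        refine lintegral_mono fun w ↦ ?_
        by_cases hw : w ∈ G
        · rw [indicator_of_mem hw]
          exact hb w
        · have : {t | (t, w) ∈ S} = ∅ := eq_empty_of_forall_notMem fun t ht ↦ hw (hSG t w ht)
          rw [this, measure_empty]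
          exact zero_le
    _ = b * P G := lintegral_indicator_const hG b

lemma mul_measure_le_of_section_le (hS : MeasurableSet S) (hT₀ : MeasurableSet T₀)
    (hG : MeasurableSet G) (ha : ∀ t ∈ T₀, P {w | (t, w) ∈ S} ≤ a)
    (hb : ∀ w ∈ G, b ≤ ν {t | (t, w) ∈ S}) (hST : ∀ t w, (t, w) ∈ S → t ∈ T₀) :
    b * P G ≤ a * ν T₀ := by
  calc b * P G = ∫⁻ _ in G, b ∂P := (setLIntegral_const _ _).symm
    _ ≤ ∫⁻ w in G, ν {t | (t, w) ∈ S} ∂P := setLIntegral_mono' hG hb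
    _ ≤ ∫⁻ w, ν {t | (t, w) ∈ S} ∂P := setLIntegral_le_lintegral _ _
    _ = ν.prod P S := (Measure.prod_apply_symm hS).symm
    _ = ∫⁻ t, P {w | (t, w) ∈ S} ∂ν := Measure.prod_apply hS
    _ ≤ ∫⁻ t, T₀.indicator (fun _ ↦ a) t ∂ν := by
        refine lintegral_mono fun t ↦ ?_
        by_cases ht : t ∈ T₀
        · rw [indicator_of_mem ht]
          exact ha t ht
        · have : {w | (t, w) ∈ S} = ∅ := eq_empty_of_forall_notMem fun w hw ↦ ht (hST t w hw)
          simp only [this, measure_empty]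
          exact zero_le
    _ = a * ν T₀ := lintegral_indicator_const hT₀ a

end Averaging

/-! ### Mass of sublevel sets versus integrability of negative powers -/

section VolumeGrowth

variable {Ω : Type*} [MeasurableSpace Ω] {μ : Measure Ω} [IsFiniteMeasure μ] {F : Ω → ℝ}

/-- If sublevel sets of `F` have measure at least of order `r ^ (2 * b)` at the level `C * r ^ 2`,
then integrability of `F ^ (-s)` forces `s ≤ b`. -/
lemma le_of_integrable_exp_neg_mul_log (hpos : ∀ᵐ ω ∂μ, 0 < F ω)
    {s b c C r₀ : ℝ} (hs : 0 ≤ s) (hc : 0 < c) (hC : 0 < C) (hr₀ : 0 < r₀)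
    (hlow : ∀ r, 0 < r → r < r₀ → c * r ^ (2 * b) ≤ μ.real {ω | F ω ≤ C * r ^ 2})
    (hint : Integrable (fun ω ↦ Real.exp (-s * Real.log (F ω))) μ) : s ≤ b := by
  by_contra! hbs
  set I := ∫ ω, Real.exp (-s * Real.log (F ω)) ∂μ
  have hineq : ∀ r, 0 < r → r < r₀ → c ≤ C ^ s * I * r ^ (2 * (s - b)) := by
    intro r hr hrr
    have hCr : 0 < C * r ^ 2 := by positivity
    have hmarkov : (C * r ^ 2) ^ (-s) * μ.real {ω | F ω ≤ C * r ^ 2} ≤ I := by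
      have hsub : ({ω | F ω ≤ C * r ^ 2} : Set Ω) ≤ᵐ[μ]
          {ω | (C * r ^ 2) ^ (-s) ≤ Real.exp (-s * Real.log (F ω))} := by
        filter_upwards [hpos] with ω hω (hle : F ω ≤ C * r ^ 2)
        change (C * r ^ 2) ^ (-s) ≤ Real.exp (-s * Real.log (F ω))
        rw [Real.rpow_def_of_pos hCr]
        have := Real.log_le_log hω hle
        exact Real.exp_le_exp.2 (by nlinarith)
      refine le_trans ?_ (mul_meas_ge_le_integral_of_nonneg
        (Filter.Eventually.of_forall fun ω ↦ (Real.exp_pos _).le) hint ((C * r ^ 2) ^ (-s)))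
      refine mul_le_mul_of_nonneg_left ?_ (by positivity)
      exact ENNReal.toReal_mono (measure_ne_top _ _) (measure_mono_ae hsub)
    have h1 := (mul_le_mul_of_nonneg_left (hlow r hr hrr)
      (by positivity : 0 ≤ (C * r ^ 2) ^ (-s))).trans hmarkov
    have h2 : (C * r ^ 2) ^ (-s) = (C ^ s * r ^ (2 * s))⁻¹ := by
      rw [Real.rpow_neg hCr.le, Real.mul_rpow hC.le (by positivity), ← Real.rpow_natCast r 2,
        ← Real.rpow_mul hr.le]
      norm_num
    have h3 : r ^ (2 * s) = r ^ (2 * b) * r ^ (2 * (s - b)) := by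
      rw [← Real.rpow_add hr]
      ring_nf
    rw [h2, h3] at h1
    have h4 : 0 < r ^ (2 * b) := by positivity
    have h5 : 0 < r ^ (2 * (s - b)) := by positivity
    have h6 : 0 < C ^ s := by positivity
    field_simp at h1
    linarith
  have hlim : Filter.Tendsto (fun r : ℝ ↦ C ^ s * I * r ^ (2 * (s - b))) (𝓝[>] 0) (𝓝 0) := by
    have h := (Real.continuousAt_rpow_const 0 (2 * (s - b)) (Or.inr (by linarith))).tendsto
    rw [Real.zero_rpow (by linarith)] at h
    simpa using (h.mono_left nhdsWithin_le_nhds).const_mul (C ^ s * I)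
  have : c ≤ 0 := by
    refine ge_of_tendsto hlim ?_
    filter_upwards [Ioo_mem_nhdsGT hr₀] with r hr using hineq r hr.1 hr.2
  linarith

/-- An exponential bound for the lower tail of `X` gives exponential integrability. -/
lemma integrable_exp_neg_mul_of_measure_le {X : Ω → ℝ} (hX : Measurable X) {b s C y₀ : ℝ}
    (hs : 0 ≤ s) (hsb : s < b)
    (htail : ∀ y ≤ y₀, μ {ω | X ω ≤ y} ≤ ENNReal.ofReal (C * Real.exp (b * y))) :
    Integrable (fun ω ↦ Real.exp (-s * X ω)) μ := by
  refine ⟨by fun_prop, ?_⟩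
  rw [hasFiniteIntegral_iff_ofReal (Filter.Eventually.of_forall fun ω ↦ (Real.exp_pos _).le)]
  set A : ℕ → Set Ω := fun n ↦ {ω | X ω ≤ y₀ - n}
  have hA (n : ℕ) : MeasurableSet (A n) := measurableSet_le hX measurable_const
  set e : ℕ → ENNReal := fun n ↦ ENNReal.ofReal (Real.exp (s * (n + 1 - y₀)))
  have hpt (ω : Ω) : ENNReal.ofReal (Real.exp (-s * X ω)) ≤
      ENNReal.ofReal (Real.exp (-s * y₀)) + ∑' n, (A n).indicator (fun _ ↦ e n) ω := by
    rcases le_or_gt y₀ (X ω) with h | h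
    · refine le_add_right (ENNReal.ofReal_le_ofReal ?_)
      exact Real.exp_le_exp.2 (by nlinarith)
    -- With `n` this floor, `y₀ - (n + 1) < X ω ≤ y₀ - n`, so the single layer `n` already dominates
    -- the exponential.
    · refine le_add_left (le_trans ?_ (ENNReal.le_tsum ⌊y₀ - X ω⌋₊))
      have h1 : ω ∈ A ⌊y₀ - X ω⌋₊ := by
        have := Nat.floor_le (sub_pos.2 h).le
        simp only [A, mem_ofPred_eq]
        linarith
      rw [indicator_of_mem h1]
      refine ENNReal.ofReal_le_ofReal (Real.exp_le_exp.2 ?_)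
      nlinarith [Nat.lt_floor_add_one (y₀ - X ω)]
  -- Geometric series of ratio `exp (s - b)`. The sign of `C` is not known, and `|C|` makes the
  -- terms nonnegative.
  have hgeo : Summable fun n : ℕ ↦ Real.exp (s * (n + 1 - y₀)) * (|C| * Real.exp (b * (y₀ - n))) := by
    have h : Summable fun n : ℕ ↦ Real.exp (s - b) ^ n :=
      summable_geometric_of_lt_one (Real.exp_pos _).le (Real.exp_lt_one_iff.2 (by linarith))
    refine (h.mul_left (|C| * Real.exp (s * (1 - y₀) + b * y₀))).congr fun n ↦ ?_
    rw [← Real.exp_nat_mul, mul_assoc, ← Real.exp_add, mul_left_comm, ← Real.exp_add]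
    ring_nf
  calc ∫⁻ ω, ENNReal.ofReal (Real.exp (-s * X ω)) ∂μ
      ≤ ∫⁻ ω, (ENNReal.ofReal (Real.exp (-s * y₀)) + ∑' n, (A n).indicator (fun _ ↦ e n) ω) ∂μ :=
        lintegral_mono hpt
    _ = ENNReal.ofReal (Real.exp (-s * y₀)) * μ univ + ∑' n, e n * μ (A n) := by
        rw [lintegral_add_left measurable_const, lintegral_const,
          lintegral_tsum fun n ↦ (measurable_const.indicator (hA n)).aemeasurable]
        simp_rw [lintegral_indicator_const (hA _)]
    _ ≤ ENNReal.ofReal (Real.exp (-s * y₀)) * μ univ + ∑' n : ℕ,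
          ENNReal.ofReal (Real.exp (s * (n + 1 - y₀)) * (|C| * Real.exp (b * (y₀ - n)))) := by
        gcongr with n
        rw [ENNReal.ofReal_mul (Real.exp_pos _).le]
        gcongr
        refine (htail _ (by simp)).trans (ENNReal.ofReal_le_ofReal ?_)
        gcongr
        exact le_abs_self C
    _ < ⊤ := by
        rw [← ENNReal.ofReal_tsum_of_nonneg (fun n ↦ by positivity) hgeo]
        exact ENNReal.add_lt_top.2 ⟨ENNReal.mul_lt_top ENNReal.ofReal_lt_top
          (measure_lt_top μ univ), ENNReal.ofReal_lt_top⟩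

end VolumeGrowth

/-! ### Lower bound for the mass near the torus of rescalings -/

section LowerBound

lemma exists_uniform_bounds_of_mem_interior {ι : Type*} [Finite ι] {K : Set ℝ} (hK : K ⊆ Ici 0)
    {x : ι → ℝ} (hx : ∀ i, x i ∈ interior K) :
    ∃ m B η : ℝ, 0 < m ∧ 1 ≤ B ∧ 0 < η ∧
      ∀ i, m ≤ x i ∧ x i ≤ B ∧ ∀ y, |y - x i| < η → y ∈ K := by
  have hpos (i : ι) : 0 < x i := by
    have := interior_mono hK (hx i)
    rwa [interior_Ici] at this
  obtain ⟨B, hB⟩ := Finite.exists_le x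
  have hm : ∀ᶠ m in 𝓝[>] (0 : ℝ), ∀ i, m ≤ x i := Filter.eventually_all.2 fun i ↦ by
    filter_upwards [Ioo_mem_nhdsGT (hpos i)] with m hm using hm.2.le
  have hη : ∀ᶠ η in 𝓝[>] (0 : ℝ), ∀ i, ∀ y, |y - x i| < η → y ∈ K :=
    Filter.eventually_all.2 fun i ↦ by
      obtain ⟨ε, hε, hball⟩ := Metric.mem_nhds_iff.1 (mem_interior_iff_mem_nhds.1 (hx i))
      filter_upwards [Ioo_mem_nhdsGT hε] with η hη y hy
      exact hball (by rw [Metric.mem_ball, Real.dist_eq]; exact hy.trans hη.2)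
  obtain ⟨m, hm, hm0⟩ := (hm.and self_mem_nhdsWithin).exists
  obtain ⟨η, hη, hη0⟩ := (hη.and self_mem_nhdsWithin).exists
  exact ⟨m, max B 1, η, hm0, le_max_right _ _, hη0,
    fun i ↦ ⟨hm i, le_max_of_le_left (hB i), hη i⟩⟩

/-- The boxes of parameters near the rescaled factorizations `(U T, T⁻¹ V)`, `T = diag t`, padded by
small columns of size `p` and rows of size `q`. -/
def factorBoxes {M N H₀ : ℕ} (d : ℕ) (U : Fin M → Fin H₀ → ℝ) (V : Fin H₀ → Fin N → ℝ)
    (r p q : ℝ) :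
    Set ((Fin H₀ → ℝ) × ((Fin M → Fin (H₀ + d) → ℝ) × (Fin (H₀ + d) → Fin N → ℝ))) :=
  {x | (∀ i k, x.2.1 i (Fin.castAdd d k) ∈ Ioo (x.1 k * U i k) (x.1 k * U i k + r)) ∧
    (∀ i k, x.2.1 i (Fin.natAdd H₀ k) ∈ Ioo 0 p) ∧
    (∀ k j, x.2.2 (Fin.castAdd d k) j ∈ Ioo (V k j / x.1 k) (V k j / x.1 k + r)) ∧
    ∀ k j, x.2.2 (Fin.natAdd H₀ k) j ∈ Ioo 0 q}

variable {M N H₀ d : ℕ} {U : Fin M → Fin H₀ → ℝ} {V : Fin H₀ → Fin N → ℝ} {r p q : ℝ}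

lemma measurableSet_Ioo_comp {Ω : Type*} [MeasurableSpace Ω] {f g h : Ω → ℝ} (hf : Measurable f)
    (hg : Measurable g) (hh : Measurable h) : MeasurableSet {x | f x ∈ Ioo (g x) (h x)} :=
  (measurableSet_lt hg hf).inter (measurableSet_lt hf hh)

lemma measurableSet_factorBoxes : MeasurableSet (factorBoxes d U V r p q) := by
  have hset : factorBoxes d U V r p q =
      (⋂ i, ⋂ k, {x | x.2.1 i (Fin.castAdd d k) ∈ Ioo (x.1 k * U i k) (x.1 k * U i k + r)}) ∩
      ((⋂ i, ⋂ k, {x | x.2.1 i (Fin.natAdd H₀ k) ∈ Ioo 0 p}) ∩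
      ((⋂ k, ⋂ j, {x | x.2.2 (Fin.castAdd d k) j ∈ Ioo (V k j / x.1 k) (V k j / x.1 k + r)}) ∩
      ⋂ k, ⋂ j, {x | x.2.2 (Fin.natAdd H₀ k) j ∈ Ioo 0 q})) := by
    ext x
    simp only [factorBoxes, mem_inter_iff, mem_iInter, mem_ofPred_eq]
  rw [hset]
  refine MeasurableSet.inter ?_ (MeasurableSet.inter ?_ (MeasurableSet.inter ?_ ?_)) <;>
  · refine MeasurableSet.iInter fun i ↦ MeasurableSet.iInter fun k ↦ ?_
    exact measurableSet_Ioo_comp (by fun_prop) (by fun_prop) (by fun_prop)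

lemma factorBoxes_section_eq (t : Fin H₀ → ℝ) :
    {w | (t, w) ∈ factorBoxes d U V r p q} =
      (univ.pi fun i ↦ univ.pi
        (Fin.append (fun k ↦ Ioo (t k * U i k) (t k * U i k + r)) fun _ ↦ Ioo 0 p)) ×ˢ
      (univ.pi (Fin.append (fun k ↦ univ.pi fun j ↦ Ioo (V k j / t k) (V k j / t k + r))
        fun _ ↦ univ.pi fun _ ↦ Ioo 0 q)) := by
  ext w
  simp only [factorBoxes, mem_ofPred_eq, mem_prod, mem_pi, mem_univ, forall_const, Fin.forall_fin_add,
    Fin.append_left, Fin.append_right, forall_and, and_assoc]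

lemma matrixGammaMeasure_prod_section_ge {φU θU φV θV : ℝ} (hφU : 0 < φU) (hθU : 0 < θU)
    (hφV : 0 < φV) (hθV : 0 < θV) {c : ℝ} (hc : 0 < c) (hr : 0 < r) (hp : 0 < p) (hq : 0 < q)
    {t : Fin H₀ → ℝ}
    (hU : ∀ i k, ENNReal.ofReal (c * r) ≤
      gammaMeasure φU θU (Ioo (t k * U i k) (t k * U i k + r)))
    (hV : ∀ k j, ENNReal.ofReal (c * r) ≤
      gammaMeasure φV θV (Ioo (V k j / t k) (V k j / t k + r)))
    (hp' : ENNReal.ofReal (c * p ^ φU) ≤ gammaMeasure φU θU (Ioo 0 p))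
    (hq' : ENNReal.ofReal (c * q ^ φV) ≤ gammaMeasure φV θV (Ioo 0 q)) :
    ENNReal.ofReal (((c * r) ^ H₀ * (c * p ^ φU) ^ d) ^ M *
        (((c * r) ^ N) ^ H₀ * ((c * q ^ φV) ^ N) ^ d)) ≤
      ((matrixGammaMeasure M (H₀ + d) φU θU).prod (matrixGammaMeasure (H₀ + d) N φV θV))
        {w | (t, w) ∈ factorBoxes d U V r p q} := by
  have := isProbabilityMeasure_gammaMeasure hφU hθU
  have := isProbabilityMeasure_gammaMeasure hφV hθV
  have := isProbabilityMeasure_matrixGammaMeasure (m := H₀ + d) (n := N) hφV hθV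
  rw [factorBoxes_section_eq, Measure.prod_prod, ENNReal.ofReal_mul (by positivity)]
  refine mul_le_mul' ?_ ?_
  · rw [matrixGammaMeasure, Measure.pi_pi, ENNReal.ofReal_pow (by positivity)]
    refine le_trans (le_of_eq ?_) (Finset.prod_le_prod' fun i _ ↦ ?_)
      (b := ∏ _i : Fin M, ENNReal.ofReal ((c * r) ^ H₀ * (c * p ^ φU) ^ d))
    · simp
    · rw [Measure.pi_pi, Fin.prod_univ_add]
      simp only [Fin.append_left, Fin.append_right]
      rw [ENNReal.ofReal_mul (by positivity), ENNReal.ofReal_pow (by positivity),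
        ENNReal.ofReal_pow (by positivity)]
      refine mul_le_mul' ?_ ?_
      · refine le_trans (le_of_eq ?_) (Finset.prod_le_prod' fun k _ ↦ hU i k)
        simp
      · refine le_trans (le_of_eq ?_) (Finset.prod_le_prod' fun k _ ↦ hp')
        simp
  · rw [matrixGammaMeasure, Measure.pi_pi, Fin.prod_univ_add]
    simp only [Fin.append_left, Fin.append_right, Measure.pi_pi]
    rw [ENNReal.ofReal_mul (by positivity), ENNReal.ofReal_pow (by positivity),
      ENNReal.ofReal_pow (by positivity), ENNReal.ofReal_pow (by positivity),
      ENNReal.ofReal_pow (by positivity)]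
    refine mul_le_mul' ?_ ?_
    · refine le_trans (le_of_eq ?_) (Finset.prod_le_prod' fun k _ ↦
        Finset.prod_le_prod' fun j _ ↦ hV k j)
      simp
    · refine le_trans (le_of_eq ?_) (Finset.prod_le_prod' fun k _ ↦
        Finset.prod_le_prod' fun j _ ↦ hq')
      simp

/-- A parameter determines its scaling up to order `r`: the entry in row `i₀` alone confines `t k`
to an interval of length `r / U i₀ k`. This is the source of the `-1` in `M + N - 1`. -/
lemma volume_section_factorBoxes_le {m : ℝ} (hm : 0 < m) (hU : ∀ i k, m ≤ U i k) (i₀ : Fin M)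
    (w : (Fin M → Fin (H₀ + d) → ℝ) × (Fin (H₀ + d) → Fin N → ℝ)) (hr : 0 < r) :
    volume {t | (t, w) ∈ factorBoxes d U V r p q} ≤ ENNReal.ofReal ((r / m) ^ H₀) := by
  have hsub : {t | (t, w) ∈ factorBoxes d U V r p q} ⊆
      univ.pi fun k ↦ Ioo ((w.1 i₀ (Fin.castAdd d k) - r) / U i₀ k)
        (w.1 i₀ (Fin.castAdd d k) / U i₀ k) := by
    intro t ht k _
    have hpos := hm.trans_le (hU i₀ k)
    obtain ⟨h1, h2⟩ := ht.1 i₀ k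
    simp only at h1 h2
    constructor
    · rw [div_lt_iff₀ hpos]
      linarith
    · rw [lt_div_iff₀ hpos]
      exact h1
  refine (measure_mono hsub).trans ?_
  rw [volume_pi_pi, ENNReal.ofReal_pow (by positivity)]
  refine (Finset.prod_le_prod' fun k _ ↦ ?_).trans (le_of_eq ?_)
    (b := ∏ _k : Fin H₀, ENNReal.ofReal (r / m))
  · rw [Real.volume_Ioo, ← sub_div]
    refine ENNReal.ofReal_le_ofReal ?_
    rw [sub_sub_cancel]
    have := hU i₀ k
    gcongr
  · simp

/-- On the boxes the loss is positive and of the order of `r ^ 2`. -/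
lemma nmfLoss_mem_of_mem_factorBoxes {A : Matrix (Fin M) (Fin N) ℝ} {B : ℝ} (hB : 1 ≤ B)
    (hA : ∀ i j, A i j = ∑ k, U i k * V k j) (hU : ∀ i k, 0 < U i k ∧ U i k ≤ B)
    (hV : ∀ k j, 0 < V k j ∧ V k j ≤ B) (hM : 0 < M) (hN : 0 < N) (hH : 0 < H₀ + d)
    (hr1 : r ≤ 1) (hp : 0 < p) (hpq : p * q ≤ r) {t : Fin H₀ → ℝ}
    (ht : ∀ k, 1 / 2 < t k ∧ t k < 2)
    {w : (Fin M → Fin (H₀ + d) → ℝ) × (Fin (H₀ + d) → Fin N → ℝ)}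
    (hw : (t, w) ∈ factorBoxes d U V r p q) :
    0 < nmfLoss (H₀ + d) A w ∧
      nmfLoss (H₀ + d) A w ≤ M * N * ((H₀ + d) * (5 * B)) ^ 2 * r ^ 2 := by
  obtain ⟨h1, h2, h3, h4⟩ := hw
  simp only at h1 h2 h3 h4
  set g : Fin M → Fin N → Fin (H₀ + d) → ℝ := fun i j ↦
    Fin.append (fun k ↦ w.1 i (Fin.castAdd d k) * w.2 (Fin.castAdd d k) j - U i k * V k j)
      fun k ↦ w.1 i (Fin.natAdd H₀ k) * w.2 (Fin.natAdd H₀ k) j with hg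
  have hsum (i j) : ∑ k, w.1 i k * w.2 k j - A i j = ∑ k, g i j k := by
    rw [hA, Fin.sum_univ_add, Fin.sum_univ_add]
    simp only [hg, Fin.append_left, Fin.append_right, Finset.sum_sub_distrib]
    ring
  -- The boxes lie strictly above the factorization, so every summand of the error is positive and
  -- the loss cannot vanish. The constant comes from `(a + r) * (b + r) - a * b ≤ 4 * B * r + r ^ 2`
  -- and `r ≤ 1 ≤ B`.
  have hgb (i j k) : 0 < g i j k ∧ g i j k ≤ 5 * B * r := by
    induction k using Fin.addCases with
    | left k =>
      simp only [hg, Fin.append_left]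
      obtain ⟨hu1, hu2⟩ := h1 i k
      obtain ⟨hv1, hv2⟩ := h3 k j
      obtain ⟨ht1, ht2⟩ := ht k
      have ht0 : 0 < t k := by linarith
      obtain ⟨hU0, hU1⟩ := hU i k
      obtain ⟨hV0, hV1⟩ := hV k j
      set a := t k * U i k
      set b := V k j / t k
      have hab : a * b = U i k * V k j := by
        simp only [a, b]
        field_simp
      have ha0 : 0 < a := by positivity
      have hb0 : 0 < b := by positivity
      have ha2 : a ≤ 2 * B := by nlinarith
      have hb2 : b ≤ 2 * B := by
        simp only [b]
        rw [div_le_iff₀ ht0]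
        nlinarith
      rw [← hab]
      constructor
      · nlinarith
      · have : w.1 i (Fin.castAdd d k) * w.2 (Fin.castAdd d k) j ≤ (a + r) * (b + r) :=
          mul_le_mul hu2.le hv2.le (by linarith) (by linarith)
        nlinarith
    | right k =>
      simp only [hg, Fin.append_right]
      obtain ⟨hu1, hu2⟩ := h2 i k
      obtain ⟨hv1, hv2⟩ := h4 k j
      refine ⟨mul_pos hu1 hv1, ?_⟩
      have : w.1 i (Fin.natAdd H₀ k) * w.2 (Fin.natAdd H₀ k) j ≤ p * q := by gcongr
      have hr0 : 0 ≤ r := by nlinarith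
      nlinarith
  have hne : Nonempty (Fin (H₀ + d)) := ⟨⟨0, hH⟩⟩
  have hSpos (i j) : 0 < ∑ k, g i j k :=
    Finset.sum_pos (fun k _ ↦ (hgb i j k).1) Finset.univ_nonempty
  have hSle (i j) : ∑ k, g i j k ≤ (H₀ + d) * (5 * B) * r := by
    calc _ ≤ ∑ _k : Fin (H₀ + d), 5 * B * r := Finset.sum_le_sum fun k _ ↦ (hgb i j k).2
      _ = _ := by simp; ring
  constructor
  · refine lt_of_lt_of_le ?_ (sq_sub_le_nmfLoss w ⟨0, hM⟩ ⟨0, hN⟩)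
    rw [hsum]
    exact pow_pos (hSpos _ _) 2
  · rw [nmfLoss_eq]
    calc _ ≤ ∑ _i : Fin M, ∑ _j : Fin N, ((H₀ + d) * (5 * B) * r) ^ 2 := by
          refine Finset.sum_le_sum fun i _ ↦ Finset.sum_le_sum fun j _ ↦ ?_
          rw [hsum]
          have := hSpos i j
          have := hSle i j
          gcongr
      _ = _ := by simp; ring

end LowerBound

section LowerBoundMeasure

variable {M N H₀ d : ℕ} {K : Set ℝ} {φU θU φV θV : ℝ}

lemma mem_nmfDomain_of_mem_factorBoxes {U : Fin M → Fin H₀ → ℝ} {V : Fin H₀ → Fin N → ℝ}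
    {r p q δ η τ B : ℝ} (hδ : 0 < d → Icc 0 δ ⊆ K)
    (hB : 1 ≤ B) (hτ : τ ≤ 1 / 2) (hτB : τ * B ≤ η / 4) (hrη : r ≤ η / 4)
    (hU : ∀ i k, 0 < U i k ∧ U i k ≤ B ∧ ∀ y, |y - U i k| < η → y ∈ K)
    (hV : ∀ k j, 0 < V k j ∧ V k j ≤ B ∧ ∀ y, |y - V k j| < η → y ∈ K)
    (hp : p ≤ δ) (hq : q ≤ δ) {t : Fin H₀ → ℝ} (ht : ∀ k, t k ∈ Ioo (1 - τ) (1 + τ))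
    {w : (Fin M → Fin (H₀ + d) → ℝ) × (Fin (H₀ + d) → Fin N → ℝ)}
    (hw : (t, w) ∈ factorBoxes d U V r p q) : w ∈ nmfDomain M N (H₀ + d) K := by
  obtain ⟨h1, h2, h3, h4⟩ := hw
  simp only at h1 h2 h3 h4
  refine ⟨fun i k ↦ ?_, fun k j ↦ ?_⟩
  · induction k using Fin.addCases with
    | left k =>
      obtain ⟨hU0, hUB, hUK⟩ := hU i k
      obtain ⟨ht1, ht2⟩ := ht k
      obtain ⟨hu1, hu2⟩ := h1 i k
      refine hUK _ (abs_lt.2 ⟨?_, ?_⟩) <;> nlinarith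
    | right k =>
      exact hδ k.pos ⟨(h2 i k).1.le, (h2 i k).2.le.trans hp⟩
  · induction k using Fin.addCases with
    | left k =>
      obtain ⟨hV0, hVB, hVK⟩ := hV k j
      obtain ⟨ht1, ht2⟩ := ht k
      obtain ⟨hv1, hv2⟩ := h3 k j
      have ht0 : 0 < t k := by linarith
      have hτ0 : 0 < τ := by linarith
      have hτV : τ * V k j ≤ η / 4 := by nlinarith
      -- As `t k ≥ 1 / 2`, division by it moves `V k j` by at most `2 * τ * B ≤ η / 2`, and the box
      -- adds at most `η / 4`.
      have h5 : V k j / t k ≤ V k j + η / 2 := by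
        rw [div_le_iff₀ ht0]
        nlinarith
      have h6 : V k j - η / 2 ≤ V k j / t k := by
        rw [le_div_iff₀ ht0]
        nlinarith
      refine hVK _ (abs_lt.2 ⟨?_, ?_⟩) <;> nlinarith
    | right k =>
      exact hδ k.pos ⟨(h4 k j).1.le, (h4 k j).2.le.trans hq⟩

/-- The sublevel sets of the loss are at least as large as suggested by the torus of rescalings of
an interior factorization. -/
theorem exists_le_nmfMeasure_sublevel (hM : 0 < M) (hN : 0 < N) (hH : 0 < H₀ + d)
    (hK : MeasurableSet K) (hKnonneg : K ⊆ Ici 0)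
    (hKzero : 0 < d → ∃ δ : ℝ, 0 < δ ∧ Icc 0 δ ⊆ K)
    (hφU : 0 < φU) (hθU : 0 < θU) (hφV : 0 < φV) (hθV : 0 < θV)
    {A : Matrix (Fin M) (Fin N) ℝ} {U : Fin M → Fin H₀ → ℝ} {V : Fin H₀ → Fin N → ℝ}
    (hU : ∀ i k, U i k ∈ interior K) (hV : ∀ k j, V k j ∈ interior K)
    (hA : ∀ i j, A i j = ∑ k, U i k * V k j) :
    ∃ c C r₀ δ : ℝ, 0 < c ∧ 0 < C ∧ 0 < r₀ ∧ r₀ ≤ δ ∧ δ ≤ 1 ∧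
      ∀ r p q : ℝ, 0 < r → r < r₀ → 0 < p → p ≤ δ → 0 < q → q ≤ δ → p * q ≤ r →
        c * (r ^ (H₀ * (M + N - 1)) * (p ^ φU) ^ (d * M) * (q ^ φV) ^ (d * N)) ≤
          (nmfMeasure (H₀ + d) K φU θU φV θV A).real
            {w | nmfLoss (H₀ + d) A w ≤ C * r ^ 2} := by
  obtain ⟨δ, hδ0, hδ1, hδK⟩ : ∃ δ : ℝ, 0 < δ ∧ δ ≤ 1 ∧ (0 < d → Icc 0 δ ⊆ K) := by
    by_cases hd : 0 < d
    · obtain ⟨δ, h1, h2⟩ := hKzero hd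
      exact ⟨min δ 1, by positivity, min_le_right _ _,
        fun _ ↦ (Icc_subset_Icc_right (min_le_left _ _)).trans h2⟩
    · exact ⟨1, one_pos, le_rfl, fun h ↦ absurd h hd⟩
  obtain ⟨m, B, η, hm, hB, hη, hb⟩ := exists_uniform_bounds_of_mem_interior hKnonneg
    (x := Sum.elim (fun x : Fin M × Fin H₀ ↦ U x.1 x.2) fun x : Fin H₀ × Fin N ↦ V x.1 x.2)
    (by rintro (x | x) <;> simp [hU, hV])
  have hbU (i k) : m ≤ U i k ∧ U i k ≤ B ∧ ∀ y, |y - U i k| < η → y ∈ K := hb (Sum.inl (i, k))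
  have hbV (k j) : m ≤ V k j ∧ V k j ≤ B ∧ ∀ y, |y - V k j| < η → y ∈ K := hb (Sum.inr (k, j))
  -- For scalings between `1 / 2` and `2` the rescaled entries lie in `[m / 2, 2 * B]`, and the side
  -- `r` is at most `1`.
  obtain ⟨c₁, hc₁, hI₁⟩ := exists_mul_le_gammaMeasure_Ioo hφU hθU (x₁ := 2 * B + 1) (half_pos hm)
  obtain ⟨c₂, hc₂, hI₂⟩ := exists_mul_le_gammaMeasure_Ioo hφV hθV (x₁ := 2 * B + 1) (half_pos hm)
  obtain ⟨c₃, hc₃, hI₃⟩ := exists_rpow_le_gammaMeasure_Ioo_zero hφU hθU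
  obtain ⟨c₄, hc₄, hI₄⟩ := exists_rpow_le_gammaMeasure_Ioo_zero hφV hθV
  set c : ℝ := min (min c₁ c₂) (min c₃ c₄)
  have hc : 0 < c := by positivity
  have hcc₁ : c ≤ c₁ := (min_le_left _ _).trans (min_le_left _ _)
  have hcc₂ : c ≤ c₂ := (min_le_left _ _).trans (min_le_right _ _)
  have hcc₃ : c ≤ c₃ := (min_le_right _ _).trans (min_le_left _ _)
  have hcc₄ : c ≤ c₄ := (min_le_right _ _).trans (min_le_right _ _)
  set τ : ℝ := min (1 / 2) (η / (4 * B))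
  have hτ0 : 0 < τ := by positivity
  have hτ : τ ≤ 1 / 2 := min_le_left _ _
  have hτB : τ * B ≤ η / 4 := by
    calc τ * B ≤ η / (4 * B) * B := by gcongr; exact min_le_right _ _
      _ = η / 4 := by field_simp
  set T₀ : Set (Fin H₀ → ℝ) := univ.pi fun _ ↦ Ioo (1 - τ) (1 + τ)
  have hT₀ : MeasurableSet T₀ := MeasurableSet.univ_pi fun _ ↦ measurableSet_Ioo
  refine ⟨(c ^ H₀ * c ^ d) ^ M * ((c ^ N) ^ H₀ * (c ^ N) ^ d) * (2 * τ) ^ H₀ * m ^ H₀,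
    M * N * ((H₀ + d) * (5 * B)) ^ 2, min (min δ (η / 4)) 1, δ, by positivity, ?_, by positivity,
    (min_le_left _ _).trans (min_le_left _ _), hδ1, fun r p q hr hrr hp hpδ hq hqδ hpq ↦ ?_⟩
  · have : (0 : ℝ) < H₀ + d := by exact_mod_cast hH
    positivity
  have hr1 : r ≤ 1 := hrr.le.trans (min_le_right _ _)
  have hrη : r ≤ η / 4 := hrr.le.trans ((min_le_left _ _).trans (min_le_right _ _))
  have htT (t) (ht : t ∈ T₀) (k) : 1 / 2 < t k ∧ t k < 2 := by
    obtain ⟨h1, h2⟩ := ht k (mem_univ k)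
    constructor <;> linarith
  have := isProbabilityMeasure_matrixGammaMeasure (m := M) (n := H₀ + d) hφU hθU
  have := isProbabilityMeasure_matrixGammaMeasure (m := H₀ + d) (n := N) hφV hθV
  set P := (matrixGammaMeasure M (H₀ + d) φU θU).prod (matrixGammaMeasure (H₀ + d) N φV θV)
  set L : Set ((Fin M → Fin (H₀ + d) → ℝ) × (Fin (H₀ + d) → Fin N → ℝ)) :=
    {w | nmfLoss (H₀ + d) A w ≤ M * N * ((H₀ + d) * (5 * B)) ^ 2 * r ^ 2}
  have hL : MeasurableSet L := measurableSet_le continuous_nmfLoss.measurable measurable_const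
  set G := L ∩ (nmfDomain M N (H₀ + d) K ∩ {w | 0 < nmfLoss (H₀ + d) A w})
  have hG : MeasurableSet G := hL.inter (measurableSet_nmfDomain_inter_pos hK)
  have havg := mul_measure_le_of_le_section (ν := (volume : Measure (Fin H₀ → ℝ))) (P := P)
    (S := factorBoxes d U V r p q ∩ Prod.fst ⁻¹' T₀) (T₀ := T₀) (G := G)
    (a := ENNReal.ofReal (((c * r) ^ H₀ * (c * p ^ φU) ^ d) ^ M *
      (((c * r) ^ N) ^ H₀ * ((c * q ^ φV) ^ N) ^ d)))
    (b := ENNReal.ofReal ((r / m) ^ H₀))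
    (measurableSet_factorBoxes.inter (measurable_fst hT₀)) hT₀ hG ?_ ?_ ?_
  · have hPG : (nmfMeasure (H₀ + d) K φU θU φV θV A).real L = P.real G := by
      rw [nmfMeasure, measureReal_restrict_apply hL]
    have hvol : volume T₀ = ENNReal.ofReal ((2 * τ) ^ H₀) := by
      rw [volume_pi_pi, ENNReal.ofReal_pow (by positivity)]
      simp only [Real.volume_Ioo, Finset.prod_const, Finset.card_univ, Fintype.card_fin]
      congr 2
      ring
    rw [hPG]
    rw [hvol] at havg
    have h := ENNReal.toReal_mono (by finiteness) havg
    rw [ENNReal.toReal_mul, ENNReal.toReal_mul, ENNReal.toReal_ofReal (by positivity),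
      ENNReal.toReal_ofReal (by positivity), ENNReal.toReal_ofReal (by positivity)] at h
    change _ ≤ _ * P.real G at h
    -- The box costs the right-hand side, and the bound on the scalings per parameter cancels `r ^
    -- H₀`. The truncated subtraction is exact since `0 < M`.
    have hexp : r ^ (H₀ * (M + N - 1)) * r ^ H₀ = r ^ (H₀ * M + H₀ * N) := by
      rw [← pow_add]
      congr 1
      obtain ⟨M', rfl⟩ : ∃ M', M = M' + 1 := ⟨M - 1, by omega⟩
      rw [show M' + 1 + N - 1 = M' + N by omega]
      ring
    rw [div_pow, div_mul_eq_mul_div, le_div_iff₀ (by positivity)] at h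
    refine le_of_mul_le_mul_left (le_trans (le_of_eq ?_) h) (pow_pos hr H₀)
    calc _ = (c ^ H₀ * c ^ d) ^ M * ((c ^ N) ^ H₀ * (c ^ N) ^ d) * (2 * τ) ^ H₀ * m ^ H₀ *
          ((r ^ (H₀ * (M + N - 1)) * r ^ H₀) * (p ^ φU) ^ (d * M) * (q ^ φV) ^ (d * N)) := by ring
      _ = _ := by
        rw [hexp]
        ring
  · intro t ht
    have hsec : {w | (t, w) ∈ factorBoxes d U V r p q ∩ Prod.fst ⁻¹' T₀} =
        {w | (t, w) ∈ factorBoxes d U V r p q} := by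
      ext w
      simp [ht]
    rw [hsec]
    refine matrixGammaMeasure_prod_section_ge hφU hθU hφV hθV hc hr hp hq (fun i k ↦ ?_)
      (fun k j ↦ ?_) ?_ ?_
    · obtain ⟨h1, h2⟩ := htT t ht k
      obtain ⟨h3, h4, -⟩ := hbU i k
      refine le_trans (ENNReal.ofReal_le_ofReal (by gcongr)) (hI₁ _ _ ?_ hr.le ?_) <;> nlinarith
    · obtain ⟨h1, h2⟩ := htT t ht k
      obtain ⟨h3, h4, -⟩ := hbV k j
      have ht0 : 0 < t k := by linarith
      refine le_trans (ENNReal.ofReal_le_ofReal (by gcongr)) (hI₂ _ _ ?_ hr.le ?_)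
      · rw [le_div_iff₀ ht0]
        nlinarith
      · have : V k j / t k ≤ 2 * B := by
          rw [div_le_iff₀ ht0]
          nlinarith
        linarith
    · exact le_trans (ENNReal.ofReal_le_ofReal (by gcongr)) (hI₃ p hp (hpδ.trans hδ1))
    · exact le_trans (ENNReal.ofReal_le_ofReal (by gcongr)) (hI₄ q hq (hqδ.trans hδ1))
  · intro w
    exact (measure_mono fun t ht ↦ ht.1).trans
      (volume_section_factorBoxes_le hm (fun i k ↦ (hbU i k).1) ⟨0, hM⟩ w hr)
  · rintro t w ⟨hw, ht : t ∈ T₀⟩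
    obtain ⟨hpos, hle⟩ := nmfLoss_mem_of_mem_factorBoxes hB hA
      (fun i k ↦ ⟨hm.trans_le (hbU i k).1, (hbU i k).2.1⟩)
      (fun k j ↦ ⟨hm.trans_le (hbV k j).1, (hbV k j).2.1⟩) hM hN hH hr1 hp hpq (htT t ht) hw
    exact ⟨hle, mem_nmfDomain_of_mem_factorBoxes hδK hB hτ hτB hrη
      (fun i k ↦ ⟨hm.trans_le (hbU i k).1, (hbU i k).2⟩)
      (fun k j ↦ ⟨hm.trans_le (hbV k j).1, (hbV k j).2⟩) hpδ hqδ (fun k ↦ ht k (mem_univ k)) hw,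
      hpos⟩

end LowerBoundMeasure

/-! ### Upper bound for the mass in the rank one case -/

section UpperBoundMeasure

variable {M N : ℕ} {a : Fin M → ℝ} {b : Fin N → ℝ} {r κ B D : ℝ}

/-- The boxes of rank one parameters near the rescaled factorizations `(t a, t⁻¹ b)`. -/
def rankOneBoxes (a : Fin M → ℝ) (b : Fin N → ℝ) (r κ B : ℝ) :
    Set (ℝ × ((Fin M → Fin 1 → ℝ) × (Fin 1 → Fin N → ℝ))) :=
  {x | (∀ i, ∀ k, x.2.1 i k ∈ Icc (x.1 * a i - r) (x.1 * a i + r) ∩ Icc κ B) ∧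
    ∀ k, ∀ j, x.2.2 k j ∈ Icc (b j / x.1 - r) (b j / x.1 + r) ∩ Icc κ B}

lemma measurableSet_rankOneBoxes : MeasurableSet (rankOneBoxes a b r κ B) := by
  have hset : rankOneBoxes a b r κ B =
      (⋂ i, ⋂ k, ({x | x.1 * a i - r ≤ x.2.1 i k} ∩ {x | x.2.1 i k ≤ x.1 * a i + r}) ∩
        ({x | κ ≤ x.2.1 i k} ∩ {x | x.2.1 i k ≤ B})) ∩
      ⋂ k, ⋂ j, ({x | b j / x.1 - r ≤ x.2.2 k j} ∩ {x | x.2.2 k j ≤ b j / x.1 + r}) ∩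
        ({x | κ ≤ x.2.2 k j} ∩ {x | x.2.2 k j ≤ B}) := by
    ext x
    simp only [rankOneBoxes, mem_inter_iff, mem_iInter, mem_ofPred_eq, mem_Icc]
  rw [hset]
  refine MeasurableSet.inter ?_ ?_ <;>
  · refine MeasurableSet.iInter fun i ↦ MeasurableSet.iInter fun k ↦ ?_
    refine MeasurableSet.inter (MeasurableSet.inter ?_ ?_) (MeasurableSet.inter ?_ ?_) <;>
    exact measurableSet_le (by fun_prop) (by fun_prop)

lemma matrixGammaMeasure_prod_rankOneBoxes_le {φU θU φV θV : ℝ} (hφU : 0 < φU) (hθU : 0 < θU)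
    (hφV : 0 < φV) (hθV : 0 < θV) {C : ℝ} (hC : 0 < C) (hr : 0 < r)
    (hU : ∀ x, gammaMeasure φU θU (Icc (x - r) (x + r) ∩ Icc κ B) ≤ ENNReal.ofReal (C * r))
    (hV : ∀ x, gammaMeasure φV θV (Icc (x - r) (x + r) ∩ Icc κ B) ≤ ENNReal.ofReal (C * r))
    (t : ℝ) :
    ((matrixGammaMeasure M 1 φU θU).prod (matrixGammaMeasure 1 N φV θV))
      {w | (t, w) ∈ rankOneBoxes a b r κ B} ≤ ENNReal.ofReal ((C * r) ^ (M + N)) := by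
  have := isProbabilityMeasure_gammaMeasure hφU hθU
  have := isProbabilityMeasure_gammaMeasure hφV hθV
  have := isProbabilityMeasure_matrixGammaMeasure (m := 1) (n := N) hφV hθV
  have hsec : {w | (t, w) ∈ rankOneBoxes a b r κ B} =
      (univ.pi fun i ↦ univ.pi fun _ ↦ Icc (t * a i - r) (t * a i + r) ∩ Icc κ B) ×ˢ
      (univ.pi fun _ ↦ univ.pi fun j ↦ Icc (b j / t - r) (b j / t + r) ∩ Icc κ B) := by
    ext w
    simp only [rankOneBoxes, mem_ofPred_eq, mem_prod, mem_pi, mem_univ, forall_const]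
  rw [hsec, Measure.prod_prod, pow_add, ENNReal.ofReal_mul (by positivity),
    ENNReal.ofReal_pow (by positivity), ENNReal.ofReal_pow (by positivity)]
  refine mul_le_mul' ?_ ?_
  · rw [matrixGammaMeasure, Measure.pi_pi]
    simp only [Measure.pi_pi, Finset.univ_unique, Finset.prod_const, Finset.card_singleton, pow_one]
    refine (Finset.prod_le_prod' fun i _ ↦ hU _).trans (le_of_eq ?_)
    simp
  · rw [matrixGammaMeasure, Measure.pi_pi]
    simp only [Measure.pi_pi, Finset.univ_unique, Finset.prod_const, Finset.card_singleton, pow_one]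
    refine (Finset.prod_le_prod' fun i _ ↦ hV _).trans (le_of_eq ?_)
    simp

lemma abs_sub_div_le_of_abs_mul_sub_le {x y c : ℝ} (hκ : 0 < κ) (hx : κ ≤ x)
    (h : |x * y - c| ≤ r) : |y - c / x| ≤ r / κ := by
  have hx0 : 0 < x := hκ.trans_le hx
  rw [show y - c / x = (x * y - c) / x by field_simp, abs_div, abs_of_pos hx0]
  have : 0 ≤ r := (abs_nonneg _).trans h
  gcongr

/-- Parameters with loss at most `r ^ 2` are close to the rescaling orbit of the true
factorization. -/
lemma mem_rankOneBoxes_of_nmfLoss_le {m : ℝ} (hm : 0 < m) (hm1 : m ≤ 1) (hB : 1 ≤ B)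
    (ha : ∀ i, m ≤ a i ∧ a i ≤ B) (hb : ∀ j, m ≤ b j ∧ b j ≤ B) (i₀ : Fin M) (j₀ : Fin N)
    (hr : 0 < r) (hrm : r ≤ m ^ 2 / 2) (hκ : κ = m ^ 2 / (2 * B))
    (hD : D = B ^ 3 / κ ^ 2 + 2 * B / (m * κ) + B + 1 / κ)
    {u : Fin M → ℝ} {v : Fin N → ℝ} (hu : ∀ i, u i ∈ Icc 0 B) (hv : ∀ j, v j ∈ Icc 0 B)
    (hloss : ∀ i j, |u i * v j - a i * b j| ≤ r) {t : ℝ}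
    (ht : t ∈ Icc (u i₀ / a i₀) (u i₀ / a i₀ + r)) :
    (∀ i, u i ∈ Icc (t * a i - D * r) (t * a i + D * r) ∩ Icc κ B) ∧
      (∀ j, v j ∈ Icc (b j / t - D * r) (b j / t + D * r) ∩ Icc κ B) ∧ t ∈ Icc 0 (B / m + 1) := by
  have hκ0 : 0 < κ := by rw [hκ]; positivity
  have hκB : κ * B = m ^ 2 / 2 := by rw [hκ]; field_simp
  -- `κ` is chosen so that `κ * B = m ^ 2 / 2 ≤ a i * b j - r`. As the other factor is at most `B`,
  -- all entries are then at least `κ`.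
  have hprod (i j) : κ * B ≤ u i * v j := by
    have h1 := (abs_le.1 (hloss i j)).1
    have h2 : m ^ 2 ≤ a i * b j := by
      rw [sq]
      exact mul_le_mul (ha i).1 (hb j).1 hm.le (hm.le.trans (ha i).1)
    rw [hκB]
    linarith
  have hB0 : 0 < B := by linarith
  have huκ (i) : κ ≤ u i := by
    refine le_of_mul_le_mul_right ((hprod i j₀).trans ?_) hB0
    exact mul_le_mul_of_nonneg_left (hv j₀).2 (hu i).1
  have hvκ (j) : κ ≤ v j := by
    refine le_of_mul_le_mul_right ((hprod i₀ j).trans ?_) hB0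
    rw [mul_comm]
    exact mul_le_mul_of_nonneg_left (hu i₀).2 (hv j).1
  have ha0 : 0 < a i₀ := hm.trans_le (ha i₀).1
  -- The scaling is read off row `i₀`, and `t` exceeds it by at most `r`. `D` adds up the errors of
  -- replacing `u` by `s a`, `v` by `b / s`, and then `s` by `t`.
  set s := u i₀ / a i₀ with hs
  have hsκ : κ / B ≤ s := by
    have := huκ i₀
    have := (ha i₀).2
    have := (hu i₀).1
    rw [hs]
    gcongr
  have hsB : s ≤ B / m := by
    have := (hu i₀).2
    have := (ha i₀).1
    rw [hs]
    gcongr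
  have hs0 : 0 < s := lt_of_lt_of_le (by positivity) hsκ
  have ht0 : 0 < t := hs0.trans_le ht.1
  have hm2 : m ^ 2 ≤ 1 := pow_le_one₀ hm.le hm1
  have hmem {x y c : ℝ} (h : |x - y| ≤ c) : x ∈ Icc (y - c) (y + c) := by
    have := abs_le.1 h
    constructor <;> linarith
  refine ⟨fun i ↦ ⟨hmem ?_, huκ i, (hu i).2⟩, fun j ↦ ⟨hmem ?_, hvκ j, (hv j).2⟩,
    ht0.le, ht.2.trans ?_⟩
  · have hai : 0 < a i := hm.trans_le (ha i).1
    -- Column `j₀` gives `b j₀ ≈ s * v j₀`. Hence `v j₀ * u i ≈ v j₀ * (s * a i)`, and `v j₀ ≥ κ`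
    -- can be divided out.
    have h1 : |b j₀ - s * v j₀| ≤ r / m := by
      rw [show b j₀ - s * v j₀ = -((u i₀ * v j₀ - a i₀ * b j₀) / a i₀) by
        rw [hs]; field_simp; ring, abs_neg, abs_div, abs_of_pos ha0]
      have := hloss i₀ j₀
      have := (ha i₀).1
      gcongr
    have h2 : |v j₀ * u i - v j₀ * (s * a i)| ≤ r + B * (r / m) := by
      rw [show v j₀ * u i - v j₀ * (s * a i)
        = (u i * v j₀ - a i * b j₀) + a i * (b j₀ - s * v j₀) by ring]
      refine (abs_add_le _ _).trans (add_le_add (hloss i j₀) ?_)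
      rw [abs_mul, abs_of_pos hai]
      exact mul_le_mul (ha i).2 h1 (abs_nonneg _) hB0.le
    have h3 := abs_sub_div_le_of_abs_mul_sub_le hκ0 (hvκ j₀) h2
    have hv0 : 0 < v j₀ := hκ0.trans_le (hvκ j₀)
    rw [mul_div_cancel_left₀ _ hv0.ne'] at h3
    have h4 : |s * a i - t * a i| ≤ B * r := by
      rw [← sub_mul, abs_mul, abs_of_pos hai, mul_comm]
      refine mul_le_mul (ha i).2 ?_ (abs_nonneg _) hB0.le
      rw [abs_sub_comm, abs_of_nonneg (by linarith [ht.1])]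
      linarith [ht.2]
    have h5 : (r + B * (r / m)) / κ ≤ (2 * B / (m * κ)) * r := by
      rw [show (2 * B / (m * κ)) * r = ((B / m) * r + B * (r / m)) / κ by field_simp; ring]
      have : 1 ≤ B / m := by rw [le_div_iff₀ hm]; linarith
      gcongr
      nlinarith
    calc |u i - t * a i| ≤ |u i - s * a i| + |s * a i - t * a i| := abs_sub_le _ _ _
      _ ≤ (2 * B / (m * κ)) * r + B * r := add_le_add (h3.trans h5) h4
      _ ≤ D * r := by
          rw [← add_mul, hD]
          refine mul_le_mul_of_nonneg_right ?_ hr.le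
          have : 0 < B ^ 3 / κ ^ 2 := by positivity
          have : 0 < 1 / κ := by positivity
          linarith
  · have hbj : 0 < b j := hm.trans_le (hb j).1
    have h1 := abs_sub_div_le_of_abs_mul_sub_le hκ0 (huκ i₀) (hloss i₀ j)
    have h2 : a i₀ * b j / u i₀ = b j / s := by
      rw [hs]
      field_simp
    rw [h2] at h1
    have h3 : |b j / s - b j / t| ≤ B ^ 3 / κ ^ 2 * r := by
      rw [show b j / s - b j / t = b j * (t - s) / (s * t) by field_simp, abs_div,
        abs_of_pos (by positivity : 0 < s * t),
        abs_of_nonneg (mul_nonneg hbj.le (by linarith [ht.1])),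
        show B ^ 3 / κ ^ 2 * r = B * r / (κ / B * (κ / B)) by field_simp]
      have h4 := (hb j).2
      have h5 : t - s ≤ r := by linarith [ht.2]
      have h6 : κ / B ≤ t := hsκ.trans ht.1
      have h7 : 0 ≤ t - s := by linarith [ht.1]
      gcongr
    calc |v j - b j / t| ≤ |v j - b j / s| + |b j / s - b j / t| := abs_sub_le _ _ _
      _ ≤ r / κ + B ^ 3 / κ ^ 2 * r := add_le_add h1 h3
      _ = (B ^ 3 / κ ^ 2 + 1 / κ) * r := by ring
      _ ≤ D * r := by
          rw [hD]
          gcongr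
          have : 0 < 2 * B / (m * κ) := by positivity
          linarith
  · have : r ≤ 1 := by linarith
    linarith

lemma exists_pos_le_and_le {ι : Type*} [Finite ι] {x : ι → ℝ} (hx : ∀ i, 0 < x i) :
    ∃ m B : ℝ, 0 < m ∧ m ≤ 1 ∧ 1 ≤ B ∧ ∀ i, m ≤ x i ∧ x i ≤ B := by
  obtain ⟨m, B, η, hm, hB, -, h⟩ := exists_uniform_bounds_of_mem_interior (K := Ici (0 : ℝ)) le_rfl
    (x := x) fun i ↦ by rw [interior_Ici]; exact hx i
  exact ⟨min m 1, B, by positivity, min_le_right _ _, hB,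
    fun i ↦ ⟨(min_le_left _ _).trans (h i).1, (h i).2.1⟩⟩

/-- In the rank one case the sublevel sets of the loss are at most as large as suggested by the
one-dimensional orbit of rescalings. -/
theorem exists_nmfMeasure_sublevel_le (hM : 0 < M) (hN : 0 < N) {K : Set ℝ} (hK : IsCompact K)
    (hKnonneg : K ⊆ Ici 0) {φU θU φV θV : ℝ} (hφU : 0 < φU) (hθU : 0 < θU) (hφV : 0 < φV)
    (hθV : 0 < θV) {A : Matrix (Fin M) (Fin N) ℝ} (ha : ∀ i, 0 < a i) (hb : ∀ j, 0 < b j)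
    (hA : ∀ i j, A i j = a i * b j) :
    ∃ C r₀ : ℝ, 0 < C ∧ 0 < r₀ ∧ ∀ r : ℝ, 0 < r → r ≤ r₀ →
      nmfMeasure 1 K φU θU φV θV A {w | nmfLoss 1 A w ≤ r ^ 2} ≤
        ENNReal.ofReal (C * r ^ (M + N - 1)) := by
  obtain ⟨B₀, hB₀⟩ := hK.bddAbove
  obtain ⟨m, B₁, hm, hm1, hB₁, hmB⟩ := exists_pos_le_and_le (x := Sum.elim a b)
    (by rintro (i | j) <;> simp [ha, hb])
  set B := max B₀ B₁
  have hB : 1 ≤ B := hB₁.trans (le_max_right _ _)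
  have ha' (i) : m ≤ a i ∧ a i ≤ B :=
    ⟨(hmB (Sum.inl i)).1, (hmB (Sum.inl i)).2.trans (le_max_right _ _)⟩
  have hb' (j) : m ≤ b j ∧ b j ≤ B :=
    ⟨(hmB (Sum.inr j)).1, (hmB (Sum.inr j)).2.trans (le_max_right _ _)⟩
  have hKB {x} (hx : x ∈ K) : x ∈ Icc 0 B := ⟨hKnonneg hx, (hB₀ hx).trans (le_max_left _ _)⟩
  set κ := m ^ 2 / (2 * B) with hκ
  have hκ0 : 0 < κ := by positivity
  set D := B ^ 3 / κ ^ 2 + 2 * B / (m * κ) + B + 1 / κ with hD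
  have hD0 : 0 < D := by positivity
  obtain ⟨C₁, hC₁, hI₁⟩ := exists_gammaMeasure_Icc_inter_le (a := φU) (r := θU) (x₁ := B) hκ0
  obtain ⟨C₂, hC₂, hI₂⟩ := exists_gammaMeasure_Icc_inter_le (a := φV) (r := θV) (x₁ := B) hκ0
  set C := max C₁ C₂
  have hC : 0 < C := lt_max_of_lt_left hC₁
  have := isProbabilityMeasure_matrixGammaMeasure (m := M) (n := 1) hφU hθU
  have := isProbabilityMeasure_matrixGammaMeasure (m := 1) (n := N) hφV hθV
  refine ⟨(C * D) ^ (M + N) * (B / m + 1), m ^ 2 / 2, by positivity, by positivity,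
    fun r hr hrm ↦ ?_⟩
  set P := (matrixGammaMeasure M 1 φU θU).prod (matrixGammaMeasure 1 N φV θV)
  have hL : MeasurableSet {w | nmfLoss 1 A w ≤ r ^ 2} :=
    measurableSet_le continuous_nmfLoss.measurable measurable_const
  set G := {w | nmfLoss 1 A w ≤ r ^ 2} ∩ (nmfDomain M N 1 K ∩ {w | 0 < nmfLoss 1 A w})
  have hG : MeasurableSet G := hL.inter (measurableSet_nmfDomain_inter_pos hK.measurableSet)
  rw [nmfMeasure, Measure.restrict_apply hL]
  change P G ≤ _
  have hDr : 0 < D * r := by positivity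
  -- Each parameter of small loss lies in the boxes for a set of scalings of length at least `r`,
  -- while each scaling carries mass of order at most `r ^ (M + N)`. Cancelling one `r` gives the
  -- exponent.
  have havg := mul_measure_le_of_section_le (ν := (volume : Measure ℝ)) (P := P)
    (S := rankOneBoxes a b (D * r) κ B ∩ Prod.fst ⁻¹' Icc 0 (B / m + 1))
    (T₀ := Icc 0 (B / m + 1)) (G := G)
    (a := ENNReal.ofReal ((C * (D * r)) ^ (M + N))) (b := ENNReal.ofReal r)
    (measurableSet_rankOneBoxes.inter (measurable_fst measurableSet_Icc)) measurableSet_Icc hG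
    (fun t _ ↦ (measure_mono fun w hw ↦ hw.1).trans
      (matrixGammaMeasure_prod_rankOneBoxes_le hφU hθU hφV hθV hC hDr
        (fun x ↦ (hI₁ x _).trans (ENNReal.ofReal_le_ofReal
          (mul_le_mul_of_nonneg_right (le_max_left _ _) hDr.le)))
        (fun x ↦ (hI₂ x _).trans (ENNReal.ofReal_le_ofReal
          (mul_le_mul_of_nonneg_right (le_max_right _ _) hDr.le))) t)) ?_ fun t w hw ↦ hw.2
  · rw [Real.volume_Icc, ← ENNReal.ofReal_mul (by positivity)] at havg
    have hpow : r ^ (M + N) = r * r ^ (M + N - 1) := by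
      rw [← pow_succ']
      congr 1
      omega
    have hr' : ENNReal.ofReal r ≠ 0 := by simpa using hr
    refine (ENNReal.mul_le_mul_iff_right hr' ENNReal.ofReal_ne_top).1 (havg.trans (le_of_eq ?_))
    rw [← ENNReal.ofReal_mul hr.le, ← mul_assoc C, mul_pow (C * D), hpow]
    congr 1
    ring
  · rintro w ⟨hw, ⟨hwU, hwV⟩, -⟩
    have hloss (i j) : |w.1 i 0 * w.2 0 j - a i * b j| ≤ r := by
      refine abs_le_of_sq_le_sq ?_ hr.le
      have := (sq_sub_le_nmfLoss (A := A) w i j).trans hw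
      simpa [hA] using this
    have hsub : Icc (w.1 ⟨0, hM⟩ 0 / a ⟨0, hM⟩) (w.1 ⟨0, hM⟩ 0 / a ⟨0, hM⟩ + r) ⊆
        {t | (t, w) ∈ rankOneBoxes a b (D * r) κ B ∩ Prod.fst ⁻¹' Icc 0 (B / m + 1)} := by
      intro t ht
      obtain ⟨h1, h2, h3⟩ := mem_rankOneBoxes_of_nmfLoss_le hm hm1 hB ha' hb' ⟨0, hM⟩ ⟨0, hN⟩ hr
        hrm hκ hD (u := fun i ↦ w.1 i 0) (v := fun j ↦ w.2 0 j) (fun i ↦ hKB (hwU i 0))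
        (fun j ↦ hKB (hwV 0 j)) hloss ht
      refine ⟨⟨fun i k ↦ ?_, fun k j ↦ ?_⟩, h3⟩
      · rw [Subsingleton.elim k 0]
        exact h1 i
      · rw [Subsingleton.elim k 0]
        exact h2 j
    refine le_trans (le_of_eq ?_) (measure_mono hsub)
    rw [Real.volume_Icc]
    ring_nf

end UpperBoundMeasure

/-! ### From mass estimates to bounds on the threshold -/

section Threshold

variable {M N H : ℕ} {K : Set ℝ} {φU θU φV θV : ℝ} {A : Matrix (Fin M) (Fin N) ℝ} {l : ℝ}

lemma measurable_log_nmfLoss : Measurable fun w ↦ Real.log (nmfLoss H A w) :=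
  continuous_nmfLoss.measurable.log

lemma ae_nmfMeasure_mem (hK : MeasurableSet K) :
    ∀ᵐ w ∂nmfMeasure H K φU θU φV θV A, w ∈ nmfDomain M N H K ∧ 0 < nmfLoss H A w :=
  ae_restrict_mem (measurableSet_nmfDomain_inter_pos hK)

lemma exists_ae_log_nmfLoss_le (hK : IsCompact K) :
    ∃ C, ∀ᵐ w ∂nmfMeasure H K φU θU φV θV A, Real.log (nmfLoss H A w) ≤ C := by
  obtain ⟨B, -, hB⟩ := exists_nmfLoss_le (M := M) (N := N) (H := H) (A := A) hK
  refine ⟨Real.log B, ?_⟩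
  filter_upwards [ae_nmfMeasure_mem hK.measurableSet] with w hw
  exact Real.log_le_log hw.2 (hB w hw.1)

/-- Here the zeta function is zero for `0 < re z`, so its continuation has no pole at all. This
disposes of empty dimensions. -/
lemma not_isNMFRLCT_of_nmfLoss_eq_zero (hK : IsCompact K) (hφU : 0 < φU) (hθU : 0 < θU)
    (hφV : 0 < φV) (hθV : 0 < θV) (h0 : ∀ w, nmfLoss H A w = 0) :
    ¬ IsNMFRLCT H K φU θU φV θV A l := by
  rintro ⟨Z, hZ, hZζ, hpole, -⟩
  have hμ : nmfMeasure H K φU θU φV θV A = 0 := by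
    simp [nmfMeasure, h0]
  have h := le_of_isPoleOf_of_integrable_exp_mul (s := |l| + 1) hZ (fun z hz ↦ by
    rw [hZζ z hz, nmfZeta_eq_complexMGF hK.measurableSet hφU hθU hφV hθV]
    rintro rfl
    simp at hz) (by positivity) (fun x _ ↦ by rw [hμ]; exact integrable_zero_measure) hpole
  linarith [le_abs_self l]

lemma IsNMFRLCT.integrable (hK : IsCompact K) (hφU : 0 < φU) (hθU : 0 < θU)
    (hφV : 0 < φV) (hθV : 0 < θV) (hl : IsNMFRLCT H K φU θU φV θV A l) {x : ℝ} (hx : -l < x) :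
    Integrable (fun w ↦ Real.exp (x * Real.log (nmfLoss H A w)))
      (nmfMeasure H K φU θU φV θV A) := by
  obtain ⟨Z, hZ, hZζ, -, hmax⟩ := hl
  have := isFiniteMeasure_nmfMeasure (M := M) (N := N) (H := H) (K := K) (A := A) hφU hθU hφV hθV
  obtain ⟨C, hC⟩ := exists_ae_log_nmfLoss_le (φU := φU) (θU := θU) (φV := φV) (θV := θV)
    (H := H) (A := A) hK
  refine integrable_exp_mul_of_isPoleOf_re_le measurable_log_nmfLoss hC hZ (fun z hz ↦ ?_) hmax hx
  rw [hZζ z hz, nmfZeta_eq_complexMGF hK.measurableSet hφU hθU hφV hθV]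
  rintro rfl
  simp at hz

/-- A lower bound of order `r ^ (2 * b)` for the volume of sublevel sets bounds the threshold. -/
lemma IsNMFRLCT.le_of_volume_ge (hK : IsCompact K) (hφU : 0 < φU) (hθU : 0 < θU)
    (hφV : 0 < φV) (hθV : 0 < θV) (hl : IsNMFRLCT H K φU θU φV θV A l) {b c C r₀ : ℝ}
    (hb : 0 ≤ b) (hc : 0 < c) (hC : 0 < C) (hr₀ : 0 < r₀)
    (hlow : ∀ r, 0 < r → r < r₀ →
      c * r ^ (2 * b) ≤ (nmfMeasure H K φU θU φV θV A).real {w | nmfLoss H A w ≤ C * r ^ 2}) :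
    l ≤ b := by
  have := isFiniteMeasure_nmfMeasure (M := M) (N := N) (H := H) (K := K) (A := A) hφU hθU hφV hθV
  -- Integrability is known only strictly to the right of the pole, hence the test with every `s <
  -- l`.
  refine le_of_forall_lt_imp_le_of_dense fun s hs ↦ ?_
  rcases le_or_gt s 0 with hs0 | hs0
  · exact hs0.trans hb
  exact le_of_integrable_exp_neg_mul_log
    ((ae_nmfMeasure_mem hK.measurableSet).mono fun w hw ↦ hw.2) hs0.le hc hC hr₀ hlow
    (hl.integrable hK hφU hθU hφV hθV (neg_lt_neg hs))

/-- An upper bound of order `r ^ n` for the volume of sublevel sets bounds the threshold from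
below. -/
lemma IsNMFRLCT.ge_of_volume_le (hK : IsCompact K) (hφU : 0 < φU) (hθU : 0 < θU)
    (hφV : 0 < φV) (hθV : 0 < θV) (hl : IsNMFRLCT H K φU θU φV θV A l) {n : ℕ} (hn : 0 < n)
    {C r₀ : ℝ} (hr₀ : 0 < r₀)
    (hup : ∀ r : ℝ, 0 < r → r ≤ r₀ →
      nmfMeasure H K φU θU φV θV A {w | nmfLoss H A w ≤ r ^ 2} ≤ ENNReal.ofReal (C * r ^ n)) :
    (n : ℝ) / 2 ≤ l := by
  obtain ⟨Z, hZ, hZζ, hpole, -⟩ := hl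
  have := isFiniteMeasure_nmfMeasure (M := M) (N := N) (H := H) (K := K) (A := A) hφU hθU hφV hθV
  obtain ⟨B, hB⟩ := exists_ae_log_nmfLoss_le (φU := φU) (θU := θU) (φV := φV) (θV := θV)
    (H := H) (A := A) hK
  have h := le_of_isPoleOf_of_integrable_exp_mul (s := (n : ℝ) / 2) hZ (fun z hz ↦ by
    rw [hZζ z hz, nmfZeta_eq_complexMGF hK.measurableSet hφU hθU hφV hθV]
    rintro rfl
    simp at hz) (by positivity) (fun x hx ↦ ?_) hpole
  · linarith
  rcases le_or_gt 0 x with hx0 | hx0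
  · exact integrable_exp_mul_of_nonneg_of_ae_le measurable_log_nmfLoss hB hx0
  rw [← neg_neg x]
  -- The substitution is `r = exp (y / 2)`, so `r ≤ r₀` becomes `y ≤ 2 * log r₀`.
  refine integrable_exp_neg_mul_of_measure_le measurable_log_nmfLoss (b := (n : ℝ) / 2)
    (y₀ := 2 * Real.log r₀) (C := C) (by linarith) (by linarith) fun y hy ↦ ?_
  have hr : Real.exp (y / 2) ≤ r₀ := by
    rw [← Real.le_log_iff_exp_le hr₀]
    linarith
  have hpow : Real.exp (y / 2) ^ n = Real.exp ((n : ℝ) / 2 * y) := by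
    rw [← Real.exp_nat_mul]
    ring_nf
  rw [← hpow]
  refine le_trans (measure_mono_ae ?_) (hup _ (Real.exp_pos _) hr)
  filter_upwards [ae_nmfMeasure_mem hK.measurableSet] with w hw (hle : Real.log _ ≤ y)
  change nmfLoss H A w ≤ Real.exp (y / 2) ^ 2
  rw [← Real.exp_nat_mul, show ((2 : ℕ) : ℝ) * (y / 2) = y by push_cast; ring]
  exact (Real.log_le_iff_le_exp hw.2).1 hle

theorem IsNMFRLCT.le_of_interior_factorization {H₀ d : ℕ} (hM : 0 < M) (hN : 0 < N)
    (hH : 0 < H₀ + d) (hK : IsCompact K) (hKnonneg : K ⊆ Ici 0)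
    (hKzero : 0 < d → ∃ δ : ℝ, 0 < δ ∧ Icc 0 δ ⊆ K)
    (hφU : 0 < φU) (hθU : 0 < θU) (hφV : 0 < φV) (hθV : 0 < θV)
    {U : Fin M → Fin H₀ → ℝ} {V : Fin H₀ → Fin N → ℝ}
    (hU : ∀ i k, U i k ∈ interior K) (hV : ∀ k j, V k j ∈ interior K)
    (hA : ∀ i j, A i j = ∑ k, U i k * V k j) (hl : IsNMFRLCT (H₀ + d) K φU θU φV θV A l) :
    l ≤ ((H₀ * (M + N - 1) : ℕ) + φU * (d * M : ℕ)) / 2 ∧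
      l ≤ ((H₀ * (M + N - 1) : ℕ) + φV * (d * N : ℕ)) / 2 := by
  obtain ⟨c, C, r₀, δ, hc, hC, hr₀, hrδ, hδ1, h⟩ := exists_le_nmfMeasure_sublevel hM hN hH
    hK.measurableSet hKnonneg hKzero hφU hθU hφV hθV hU hV hA
  have hδ : 0 < δ := hr₀.trans_le hrδ
  have hpow (r φ : ℝ) (n k : ℕ) (hr : 0 < r) :
      r ^ (2 * ((n + φ * k) / 2)) = r ^ n * (r ^ φ) ^ k := by
    rw [mul_div_cancel₀ _ (two_ne_zero), Real.rpow_add hr, Real.rpow_natCast,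
      Real.rpow_mul hr.le, Real.rpow_natCast]
  -- Two extreme choices of padding: `(p, q) = (r, δ)` shrinks only the extra columns, `(δ, r)` only
  -- the extra rows. In both cases `p * q ≤ r` because `δ ≤ 1`.
  constructor
  · refine hl.le_of_volume_ge hK hφU hθU hφV hθV (by positivity)
      (c := c * (δ ^ φV) ^ (d * N)) (by positivity) hC hr₀ fun r hr hrr ↦ ?_
    rw [hpow _ _ _ _ hr]
    refine le_trans (le_of_eq ?_) (h r r δ hr hrr hr (hrr.le.trans hrδ) hδ le_rfl (by nlinarith))
    ring
  · refine hl.le_of_volume_ge hK hφU hθU hφV hθV (by positivity)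
      (c := c * (δ ^ φU) ^ (d * M)) (by positivity) hC hr₀ fun r hr hrr ↦ ?_
    rw [hpow _ _ _ _ hr]
    refine le_trans (le_of_eq ?_) (h r δ r hr hrr hδ le_rfl hr (hrr.le.trans hrδ) (by nlinarith))
    ring

end Threshold

theorem theorem3p1 (M N H H₀ : ℕ) (hH : H₀ ≤ H)
    (K : Set ℝ) (hK : IsCompact K) (hKnonneg : K ⊆ Ici 0)
    (hKzero : H₀ < H → ∃ δ : ℝ, 0 < δ ∧ Icc 0 δ ⊆ K)
    (φU θU φV θV : ℝ) (hφU : 0 < φU) (hθU : 0 < θU) (hφV : 0 < φV) (hθV : 0 < θV)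
    (U₀ : Matrix (Fin M) (Fin H₀) ℝ) (V₀ : Matrix (Fin H₀) (Fin N) ℝ)
    (hU₀ : ∀ i k, 0 < U₀ i k) (hV₀ : ∀ k j, 0 < V₀ k j)
    (hrank : nonnegRank (U₀ * V₀) = H₀)
    (hreal : ∃ (U₁ : Matrix (Fin M) (Fin H₀) ℝ) (V₁ : Matrix (Fin H₀) (Fin N) ℝ),
      (∀ i k, U₁ i k ∈ interior K) ∧ (∀ k j, V₁ k j ∈ interior K) ∧ U₁ * V₁ = U₀ * V₀)
    (l : ℝ) (hl : IsNMFRLCT H K φU θU φV θV (U₀ * V₀) l) :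
    l ≤ 1 / 2 * (((H : ℝ) - H₀) * min (M * φU) (N * φV) + H₀ * ((M : ℝ) + N - 1)) ∧
    (H = 1 → H₀ = 1 →
      l = 1 / 2 * (((H : ℝ) - H₀) * min (M * φU) (N * φV) + H₀ * ((M : ℝ) + N - 1))) := by
  -- If a dimension is zero, the loss vanishes identically (`H = 0` forces `H₀ = 0`), and then no
  -- threshold exists.
  have hMN : 0 < M ∧ 0 < N ∧ 0 < H := by
    by_contra hdeg
    refine not_isNMFRLCT_of_nmfLoss_eq_zero hK hφU hθU hφV hθV (fun w ↦ ?_) hl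
    rw [nmfLoss_eq]
    refine Finset.sum_eq_zero fun i _ ↦ Finset.sum_eq_zero fun j _ ↦ ?_
    obtain rfl : H = 0 := by
      by_contra hH0
      exact hdeg ⟨i.pos, j.pos, Nat.pos_of_ne_zero hH0⟩
    obtain rfl : H₀ = 0 := by omega
    simp [Matrix.mul_apply]
  obtain ⟨hM, hN, hHpos⟩ := hMN
  obtain ⟨d, rfl⟩ := Nat.exists_eq_add_of_le hH
  obtain ⟨U₁, V₁, hU₁, hV₁, hUV⟩ := hreal
  have hcast : ((M + N - 1 : ℕ) : ℝ) = M + N - 1 := by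
    rw [Nat.cast_sub (by omega)]
    push_cast
    ring
  have hle : l ≤ 1 / 2 *
      ((((H₀ + d : ℕ) : ℝ) - H₀) * min (M * φU) (N * φV) + H₀ * ((M : ℝ) + N - 1)) := by
    obtain ⟨h1, h2⟩ := hl.le_of_interior_factorization hM hN hHpos hK hKnonneg
      (fun hd ↦ hKzero (by omega)) hφU hθU hφV hθV hU₁ hV₁
      (fun i j ↦ by rw [← hUV, Matrix.mul_apply])
    push_cast [hcast] at h1 h2 ⊢
    rcases min_choice (M * φU) (N * φV) with h | h <;> rw [h] <;> linarith
  refine ⟨hle, fun h1 h2 ↦ le_antisymm hle ?_⟩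
  subst h2
  obtain rfl : d = 0 := by omega
  -- This direction needs only a positive factorization, not one inside `K`, so the column `U₀` and
  -- the row `V₀` serve directly.
  obtain ⟨C, r₀, -, hr₀, hup⟩ := exists_nmfMeasure_sublevel_le hM hN hK hKnonneg hφU hθU hφV hθV
    (A := U₀ * V₀) (a := fun i ↦ U₀ i 0) (b := fun j ↦ V₀ 0 j) (fun i ↦ hU₀ i 0)
    (fun j ↦ hV₀ 0 j) (fun i j ↦ by simp [Matrix.mul_apply])
  have hge := IsNMFRLCT.ge_of_volume_le hK hφU hθU hφV hθV hl (by omega : 0 < M + N - 1) hr₀ hup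
  rw [hcast] at hge
  push_cast
  linarith
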